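/- Let $\mathbb D$ be the open unit disk with normalized area measure $dA=\frac1\pi\,r\,dr\,d\theta$, let $L^2_a(\mathbb D)$ be the Bergman space of holomorphic functions in $L^2(\mathbb D,dA)$, and let $P:L^2(\mathbb D,dA)\to L^2_a(\mathbb D)$ be the orthogonal projection. For an (essentially) bounded measurable function $g$ on $\mathbb D$, let $T_g$ be the Toeplitz operator on $L^2_a(\mathbb D)$ given by $T_g u=P(gu)$. Theorem. Let $f\in L^\infty(\mathbb D,dA)$, and suppose that its polar decomposition is truncated above: there are an integer $N$ and functions $f_k\in L^2([0,1],r\,dr)$ for $k\le N$ such that $$f(re^{i\theta})=\sum_{k=-\infty}^{N}e^{ik\theta}f_k(r),$$ the series converging unconditionally in $L^2(\mathbb D,dA)$. If $T_f\,T_{z^2+\bar z^2}=T_{z^2+\bar z^2}\,T_f$, then there are constants $c_2,c_0\in\mathbb C$ such that $f(z)=c_2(z^2+\bar z^2)+c_0$ for almost every $z\in\mathbb D$; moreover, $T_f=Q(T_{z^2+\bar z^2})$ for some polynomial $Q\in\mathbb C[X]$ of degree at most $1$. -/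

import Mathlib

open MeasureTheory Filter Topology Metric
open scoped ENNReal ComplexConjugate

noncomputable section

/-- The normalized area measure `dA = r dr dθ / π` on the open unit disk, as a measure on `ℂ`. -/
def diskMeasure : Measure ℂ :=
  (ENNReal.ofReal Real.pi)⁻¹ • (volume : Measure ℂ).restrict (ball (0 : ℂ) 1)

instance diskMeasure_isProbabilityMeasure : IsProbabilityMeasure diskMeasure := by
  constructor
  have h0 : ENNReal.ofReal Real.pi ≠ 0 := by simpa using Real.pi_pos
  have h : ENNReal.ofReal Real.pi = (NNReal.pi : ℝ≥0∞) := by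
    rw [← NNReal.coe_real_pi, ENNReal.ofReal_coe_nnreal]
  simp only [diskMeasure, Measure.smul_apply, Measure.restrict_apply_univ, Complex.volume_ball,
    smul_eq_mul, ENNReal.ofReal_one, one_pow, one_mul, ← h]
  exact ENNReal.inv_mul_cancel h0 ENNReal.ofReal_ne_top

theorem ae_diskMeasure_iff {p : ℂ → Prop} :
    (∀ᵐ z ∂diskMeasure, p z) ↔ ∀ᵐ z ∂(volume : Measure ℂ).restrict (ball (0 : ℂ) 1), p z := by
  have h0 : (ENNReal.ofReal Real.pi)⁻¹ ≠ 0 := by simp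
  unfold diskMeasure
  rw [Measure.ae_ennreal_smul_measure_iff h0]

theorem ae_mem_ball_diskMeasure : ∀ᵐ z ∂diskMeasure, z ∈ ball (0 : ℂ) 1 :=
  ae_diskMeasure_iff.2 (ae_restrict_mem measurableSet_ball)

/-- Area sub-mean value property. -/
theorem mul_enorm_le_lintegral_ball {h : ℂ → ℂ} {c : ℂ} {R : ℝ}
    (hh : DifferentiableOn ℂ h (closedBall c R)) :
    (∫⁻ r in Set.Ioo (0 : ℝ) R, ENNReal.ofReal (2 * Real.pi * r)) * ‖h c‖ₑ
      ≤ ∫⁻ z in ball c R, ‖h z‖ₑ := by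
  have key : ∀ r ∈ Set.Ioo (0 : ℝ) R, ENNReal.ofReal (2 * Real.pi) * ‖h c‖ₑ ≤
      ∫⁻ θ in Set.Ioo (-Real.pi) Real.pi, ‖h (circleMap c r θ)‖ₑ := by
    intro r hr
    have h1 : Real.circleAverage h c r = h c := by
      apply DiffContOnCl.circleAverage
      apply DifferentiableOn.diffContOnCl
      rw [abs_of_pos hr.1, closure_ball _ hr.1.ne']
      exact hh.mono (closedBall_subset_closedBall hr.2.le)
    have h2 : ∫ θ in (-Real.pi)..Real.pi, h (circleMap c r θ) = (2 * Real.pi : ℝ) • h c := by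
      have hp : Function.Periodic (fun θ => h (circleMap c r θ)) (2 * Real.pi) := fun θ => by
        simp only [periodic_circleMap c r θ]
      have := hp.intervalIntegral_add_eq (-Real.pi) 0
      rw [show -Real.pi + 2 * Real.pi = Real.pi by ring, zero_add] at this
      rw [this, ← h1, Real.circleAverage_def, smul_smul, mul_inv_cancel₀ (by positivity), one_smul]
    rw [intervalIntegral.integral_of_le (by linarith [Real.pi_pos]),
      integral_Ioc_eq_integral_Ioo] at h2
    calc ENNReal.ofReal (2 * Real.pi) * ‖h c‖ₑ = ‖(2 * Real.pi : ℝ) • h c‖ₑ := by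
          rw [enorm_smul, Real.enorm_eq_ofReal (by positivity)]
      _ ≤ _ := by
          rw [← h2]; exact enorm_integral_le_lintegral_enorm _
  have hc : ContinuousOn h (ball c R) := hh.continuousOn.mono ball_subset_closedBall
  have hmeas : Measurable ((ball c R).indicator h) := by
    classical
    have := hc.measurable_piecewise (g := fun _ => (0 : ℂ)) continuousOn_const measurableSet_ball
    rwa [← Set.piecewise_eq_indicator]
  have e1 : ∫⁻ z in ball c R, ‖h z‖ₑ = ∫⁻ z, ‖(ball c R).indicator h (c + z)‖ₑ := by
    rw [lintegral_add_left_eq_self (fun z => ‖(ball c R).indicator h z‖ₑ) c,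
      ← lintegral_indicator measurableSet_ball]
    congr 1; ext z
    by_cases hz : z ∈ ball c R <;> simp [hz]
  rw [e1, ← Complex.lintegral_comp_polarCoord_symm,
    show polarCoord.target = Set.Ioi (0 : ℝ) ×ˢ Set.Ioo (-Real.pi) Real.pi from rfl,
    Measure.volume_eq_prod, ← Measure.prod_restrict, lintegral_prod _ (by
      have : Measurable fun p : ℝ × ℝ => Complex.polarCoord.symm p := by
        simp only [Complex.polarCoord_symm_apply]; fun_prop
      exact Measurable.aemeasurable (by fun_prop))]
  calc _ = ∫⁻ r in Set.Ioo (0 : ℝ) R, ENNReal.ofReal (2 * Real.pi * r) * ‖h c‖ₑ := by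
        rw [lintegral_mul_const _ (by fun_prop)]
    _ ≤ ∫⁻ r in Set.Ioo (0 : ℝ) R, ∫⁻ θ in Set.Ioo (-Real.pi) Real.pi, ENNReal.ofReal r •
          ‖(ball c R).indicator h (c + Complex.polarCoord.symm (r, θ))‖ₑ := by
        refine setLIntegral_mono' measurableSet_Ioo fun r hr => ?_
        have : ∀ θ : ℝ, (ball c R).indicator h (c + Complex.polarCoord.symm (r, θ))
            = h (circleMap c r θ) := by
          intro θ
          have e : c + Complex.polarCoord.symm (r, θ) = circleMap c r θ := by
            rw [Complex.polarCoord_symm_apply, circleMap, Complex.exp_mul_I]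
            simp
          rw [e, Set.indicator_of_mem]
          exact circleMap_mem_closedBall c hr.1.le θ |> fun h => by
            simp [mem_ball, dist_eq_norm, circleMap, abs_of_pos hr.1, hr.2]
        simp only [this, smul_eq_mul]
        rw [lintegral_const_mul' _ _ ENNReal.ofReal_ne_top, mul_comm (2 * Real.pi) r,
          ENNReal.ofReal_mul hr.1.le, mul_assoc]
        gcongr
        exact key r hr
    _ ≤ ∫⁻ r in Set.Ioi (0 : ℝ), ∫⁻ θ in Set.Ioo (-Real.pi) Real.pi, ENNReal.ofReal r •
          ‖(ball c R).indicator h (c + Complex.polarCoord.symm (r, θ))‖ₑ :=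
        lintegral_mono_set Set.Ioo_subset_Ioi_self


/-- Functions holomorphic on the disk are pointwise controlled by their `L¹` norm, uniformly
near a given point. -/
theorem exists_enorm_le_eLpNorm {z₀ : ℂ} (hz₀ : z₀ ∈ ball (0 : ℂ) 1) :
    ∃ r > 0, ∃ C : ℝ≥0∞, C ≠ ∞ ∧ ball z₀ r ⊆ ball (0 : ℂ) 1 ∧
      ∀ h : ℂ → ℂ, DifferentiableOn ℂ h (ball (0 : ℂ) 1) → ∀ c ∈ ball z₀ r,
        ‖h c‖ₑ ≤ C * eLpNorm h 1 diskMeasure := by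
  have hz : ‖z₀‖ < 1 := by simpa using hz₀
  set r : ℝ := (1 - ‖z₀‖) / 3 with hr
  have hr0 : 0 < r := by rw [hr]; linarith
  set A : ℝ≥0∞ := ∫⁻ r in Set.Ioo (0 : ℝ) r, ENNReal.ofReal (2 * Real.pi * r) with hA
  have hA0 : A ≠ 0 := by
    rw [hA, ← pos_iff_ne_zero, setLIntegral_pos_iff (by fun_prop)]
    have : Set.Ioo (0 : ℝ) r ⊆ (Function.support fun r : ℝ => ENNReal.ofReal (2 * Real.pi * r)) ∩
        Set.Ioo 0 r := fun x hx => ⟨by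
          have := hx.1
          simp only [Function.mem_support, ne_eq, ENNReal.ofReal_eq_zero, not_le]
          positivity, hx⟩
    exact lt_of_lt_of_le (by simpa using hr0) (measure_mono this)
  have hAt : A ≠ ∞ := by
    have : A ≤ ∫⁻ _ in Set.Ioo (0 : ℝ) r, ENNReal.ofReal (2 * Real.pi * r) :=
      setLIntegral_mono' measurableSet_Ioo fun x hx => by
        have := hx.2.le
        gcongr
    refine ne_top_of_le_ne_top ?_ this
    rw [setLIntegral_const, Real.volume_Ioo]
    exact ENNReal.mul_ne_top ENNReal.ofReal_ne_top ENNReal.ofReal_ne_top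
  have hsub : ∀ c ∈ ball z₀ r, closedBall c r ⊆ ball (0 : ℂ) 1 := by
    intro c hc w hw
    rw [mem_ball] at hc
    rw [mem_closedBall] at hw
    have h1 := dist_triangle w c 0
    have h2 := dist_triangle c z₀ 0
    rw [dist_zero_right z₀] at h2
    rw [mem_ball]
    linarith
  refine ⟨r, hr0, A⁻¹ * ENNReal.ofReal Real.pi,
    ENNReal.mul_ne_top (ENNReal.inv_ne_top.2 hA0) ENNReal.ofReal_ne_top,
    fun c hc => hsub c hc (mem_closedBall_self hr0.le), fun h hh c hc => ?_⟩
  have h1 := mul_enorm_le_lintegral_ball (hh.mono (hsub c hc))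
  have h2 : ∫⁻ z in ball c r, ‖h z‖ₑ ≤ ENNReal.ofReal Real.pi * eLpNorm h 1 diskMeasure := by
    have h0 : ENNReal.ofReal Real.pi ≠ 0 := by simpa using Real.pi_pos
    rw [eLpNorm_one_eq_lintegral_enorm, diskMeasure, lintegral_smul_measure, smul_eq_mul,
      ← mul_assoc, ENNReal.mul_inv_cancel h0 ENNReal.ofReal_ne_top, one_mul]
    exact lintegral_mono_set (ball_subset_closedBall.trans (hsub c hc))
  have h3 := h1.trans h2
  rw [mul_assoc]
  calc ‖h c‖ₑ = A⁻¹ * (A * ‖h c‖ₑ) := by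
        rw [← mul_assoc, ENNReal.inv_mul_cancel hA0 hAt, one_mul]
    _ ≤ _ := by gcongr

/-- The analytic Bergman space `L²ₐ(𝔻)`: the (classes of) square integrable functions on the unit
disk that are holomorphic there. -/
def bergmanSpace : Submodule ℂ (Lp ℂ 2 diskMeasure) where
  carrier := {u | ∃ h : ℂ → ℂ, DifferentiableOn ℂ h (ball (0 : ℂ) 1) ∧ u =ᵐ[diskMeasure] h}
  zero_mem' := ⟨0, differentiableOn_const 0, Lp.coeFn_zero ℂ 2 diskMeasure⟩
  add_mem' := by
    rintro u v ⟨h, hh, hu⟩ ⟨k, hk, hv⟩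
    exact ⟨h + k, hh.add hk, (Lp.coeFn_add u v).trans (hu.add hv)⟩
  smul_mem' := by
    rintro a u ⟨h, hh, hu⟩
    exact ⟨a • h, hh.const_smul a, (Lp.coeFn_smul a u).trans (hu.const_smul a)⟩

theorem isClosed_bergmanSpace :
    IsClosed (bergmanSpace : Set (Lp ℂ 2 diskMeasure)) := by
  refine IsSeqClosed.isClosed fun u g hu hug => ?_
  choose h hh hae using hu
  have hL : ∀ m n, eLpNorm (h m - h n) 1 diskMeasure ≤ edist (u m) (u n) := by
    intro m n
    have e : (u m - u n : ℂ → ℂ) =ᵐ[diskMeasure] h m - h n := (hae m).sub (hae n)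
    rw [Lp.edist_def, ← eLpNorm_congr_ae e]
    exact eLpNorm_le_eLpNorm_of_exponent_le (by norm_num)
      ((Lp.aestronglyMeasurable _).sub (Lp.aestronglyMeasurable _))
  have hC := EMetric.cauchySeq_iff.1 hug.cauchySeq
  have hunif : ∀ z₀ ∈ ball (0 : ℂ) 1, ∃ r > 0, UniformCauchySeqOn h atTop (ball z₀ r) := by
    intro z₀ hz₀
    obtain ⟨r, hr, C, hCt, -, hb⟩ := exists_enorm_le_eLpNorm hz₀
    refine ⟨r, hr, ?_⟩
    intro V hV
    obtain ⟨ε, hε, hεV⟩ := mem_uniformity_edist.1 hV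
    obtain ⟨δ, hδ, hδε⟩ : ∃ δ > 0, C * δ < ε := by
      obtain ⟨d, hd, hd'⟩ := ENNReal.exists_nnreal_pos_mul_lt hCt hε.ne'
      exact ⟨d, by exact_mod_cast hd, by rwa [mul_comm]⟩
    obtain ⟨M, hM⟩ := hC δ hδ
    filter_upwards [(eventually_ge_atTop M).prod_mk (eventually_ge_atTop M)]
    rintro ⟨m, n⟩ ⟨hm, hn⟩ z hz
    refine hεV ?_
    rw [edist_eq_enorm_sub]
    calc ‖h m z - h n z‖ₑ ≤ C * eLpNorm (h m - h n) 1 diskMeasure :=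
          hb (h m - h n) ((hh m).sub (hh n)) z hz
      _ ≤ C * δ := by gcongr; exact (hL m n).trans (hM m hm n hn).le
      _ < ε := hδε
  have hpt : ∀ z : ℂ, ∃ w, z ∈ ball (0 : ℂ) 1 → Tendsto (fun n => h n z) atTop (𝓝 w) := by
    intro z
    by_cases hz : z ∈ ball (0 : ℂ) 1
    · obtain ⟨r, hr, hr'⟩ := hunif z hz
      obtain ⟨w, hw⟩ := cauchySeq_tendsto_of_complete (hr'.cauchySeq (mem_ball_self hr))
      exact ⟨w, fun _ => hw⟩
    · exact ⟨0, fun h => absurd h hz⟩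
  choose H hH using hpt
  have hloc : TendstoLocallyUniformlyOn h H atTop (ball (0 : ℂ) 1) := by
    intro V hV z hz
    obtain ⟨r, hr, hr'⟩ := hunif z hz
    have hr'' : UniformCauchySeqOn h atTop (ball z r ∩ ball 0 1) := hr'.mono Set.inter_subset_left
    refine ⟨ball z r ∩ ball 0 1, inter_mem (mem_nhdsWithin_of_mem_nhds (ball_mem_nhds z hr))
      self_mem_nhdsWithin, ?_⟩
    exact hr''.tendstoUniformlyOn_of_tendsto (fun x hx => hH x hx.2) V hV
  refine ⟨H, hloc.differentiableOn (Eventually.of_forall hh) isOpen_ball, ?_⟩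
  obtain ⟨ns, hns, hlim⟩ := (tendstoInMeasure_of_tendsto_Lp hug).exists_seq_tendsto_ae
  filter_upwards [hlim, ae_all_iff.2 hae, ae_mem_ball_diskMeasure] with z hz hz' hzb
  refine tendsto_nhds_unique hz ?_
  simp only [hz']
  exact (hH z hzb).comp hns.tendsto_atTop

instance bergmanSpace_completeSpace : CompleteSpace bergmanSpace :=
  isClosed_bergmanSpace.completeSpace_coe

/-- The Bergman projection `P`: the orthogonal projection of `L²(𝔻, dA)` onto `L²ₐ(𝔻)`. -/
def bergmanProjection : Lp ℂ 2 diskMeasure →L[ℂ] bergmanSpace :=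
  bergmanSpace.orthogonalProjectionOnto

/-- Multiplication by a bounded symbol, as an operator on `L²(𝔻, dA)`. -/
def multiplicationOperator (f : Lp ℂ ∞ diskMeasure) :
    Lp ℂ 2 diskMeasure →L[ℂ] Lp ℂ 2 diskMeasure :=
  (ContinuousLinearMap.mul ℂ ℂ).holderL diskMeasure ∞ 2 2 f

theorem multiplicationOperator_coeFn (f : Lp ℂ ∞ diskMeasure) (u : Lp ℂ 2 diskMeasure) :
    multiplicationOperator f u =ᵐ[diskMeasure] fun z => f z * u z :=
  (ContinuousLinearMap.mul ℂ ℂ).coeFn_holder f u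

/-- The Toeplitz operator `T_f u = P (f u)` on the Bergman space, for an (essentially) bounded
symbol `f`. -/
def toeplitz (f : ℂ → ℂ) (hf : MemLp f ∞ diskMeasure) : bergmanSpace →L[ℂ] bergmanSpace :=
  bergmanProjection ∘L multiplicationOperator (hf.toLp f) ∘L bergmanSpace.subtypeL

/-- The harmonic symbol `z ↦ z² + z̄²`. -/
def sqAddConjSq (z : ℂ) : ℂ := z ^ 2 + conj z ^ 2

theorem sqAddConjSq_memLp : MemLp sqAddConjSq ∞ diskMeasure := by
  have hc : Continuous sqAddConjSq := by unfold sqAddConjSq; fun_prop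
  refine memLp_top_of_bound hc.aestronglyMeasurable 2 ?_
  filter_upwards [ae_mem_ball_diskMeasure] with z hz
  have hz : ‖z‖ < 1 := by simpa using hz
  have h1 : ‖z‖ ^ 2 ≤ 1 := pow_le_one₀ (norm_nonneg z) hz.le
  calc ‖z ^ 2 + conj z ^ 2‖ ≤ ‖z ^ 2‖ + ‖conj z ^ 2‖ := norm_add_le _ _
    _ ≤ 2 := by rw [norm_pow, norm_pow, RCLike.norm_conj]; linarith

/-- The measure `r dr` on `[0, 1]`. -/
def radialMeasure : Measure ℝ :=
  ((volume : Measure ℝ).restrict (Set.Icc 0 1)).withDensity fun r => ENNReal.ofReal r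

/-- The quasihomogeneous function `r e^{iθ} ↦ e^{ikθ} φ(r)` of order `k`. -/
def quasihomogeneous (k : ℤ) (φ : ℝ → ℂ) (z : ℂ) : ℂ :=
  Complex.exp (k * z.arg * Complex.I) * φ ‖z‖

/-- `f(re^{iθ}) = ∑_{k ≤ N} e^{ikθ} φ_k(r)`: each `φ_k` lies in `L²([0,1], r dr)` and the series
converges (unconditionally) to `f` in `L²(𝔻, dA)`. -/
structure HasTruncatedPolarDecomposition (f : ℂ → ℂ) (N : ℤ) (φ : ℤ → ℝ → ℂ) : Prop where
  memLp : ∀ k ≤ N, MemLp (φ k) 2 radialMeasure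
  tendsto : Tendsto
    (fun s : Finset (Set.Iic N) =>
      eLpNorm (fun z => f z - ∑ k ∈ s, quasihomogeneous k (φ k) z) 2 diskMeasure)
    atTop (𝓝 0)

end

/-! The matrix entries of `T_f` against monomials are the moments `M a b = ∫ f z^a z̄^b dA`. Since
`T_{z²+z̄²}` sends `z^n` to `z^(n+2) + c_n z^(n-2)` with `c_n = (n-1)/(n+1)` for `n ≥ 1` and `c_0 =
0`, commutation becomes a linear recurrence for `M` (`CommutationRelations`). It couples only
diagonals `b - a = k` and `b - a = k + 4`.

Truncation makes all diagonals of large index vanish. Subtracting the affine symbol with the same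
moments `(0,0)` and `(0,2)` preserves this and the recurrence. It remains to descend from `k + 4` to
`k` (`moment_eq_zero_of_commutationRelations`) and to recover the function from its moments by
Stone-Weierstrass (`ae_eq_zero_of_moment_eq_zero`).

For `k ≤ -2` the recurrence alone suffices. For `k ≥ 0` it determines the entries `M (2j) (2j+k)`
from `M 0 k`; polynomial approximation in `ρ = |z|⁴` then controls the odd entries, so the diagonal
vanishes with `M 0 k`. This settles `k = 0, 2` by normalization, and the same approximation settles
`k = -1`. In the other cases `M 0 k = 0` comes from solvability on diagonal `k - 4`. For `k ≥ 3` a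
sequence of integrals against `ρ^j` cannot be zero for all `j ≥ 1` and nonzero at `j = 0`
(`DiagonalVanishes.of_three_le`). For `k = 1` the weight needed there is too singular at the origin,
and boundedness of `f` is used instead (`DiagonalVanishes.one`). -/

/-! ### Integrals of monomials and homogeneous functions over disks. -/

theorem integral_diskMeasure (F : ℂ → ℂ) :
    ∫ z, F z ∂diskMeasure = (Real.pi : ℂ)⁻¹ * ∫ z in ball (0 : ℂ) 1, F z := by
  rw [diskMeasure, integral_smul_measure, ENNReal.toReal_inv, ENNReal.toReal_ofReal Real.pi_pos.le,
    Complex.real_smul, Complex.ofReal_inv]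

theorem setIntegral_ball_rotation (R θ : ℝ) (F : ℂ → ℂ) :
    ∫ z in ball (0 : ℂ) R, F (Complex.exp (θ * Complex.I) * z) = ∫ z in ball (0 : ℂ) R, F z := by
  have h := (rotation (Circle.exp θ)).measurePreserving
  have h' := h.setIntegral_preimage_emb
    (rotation (Circle.exp θ)).toHomeomorph.measurableEmbedding F (ball (0 : ℂ) R)
  have hp : (rotation (Circle.exp θ)) ⁻¹' ball (0 : ℂ) R = ball 0 R := by
    ext z
    rw [Set.mem_preimage, mem_ball_zero_iff, mem_ball_zero_iff, LinearIsometryEquiv.norm_map]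
  rw [hp] at h'
  simpa using h'

/-- Rotation by `π / k` preserves the integral and changes the sign of the integrand. -/
theorem setIntegral_ball_eq_zero_of_homogeneous {R : ℝ} {k : ℤ} (hk : k ≠ 0) {F : ℂ → ℂ}
    (hF : ∀ θ : ℝ, ∀ z ≠ 0,
      F (Complex.exp (θ * Complex.I) * z) = Complex.exp (k * θ * Complex.I) * F z) :
    ∫ z in ball (0 : ℂ) R, F z = 0 := by
  have hk' : (k : ℂ) ≠ 0 := by exact_mod_cast hk
  have h := setIntegral_ball_rotation R (Real.pi / k) F
  have h2 : ∫ z in ball (0 : ℂ) R, F (Complex.exp ((Real.pi / k : ℝ) * Complex.I) * z)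
      = ∫ z in ball (0 : ℂ) R, - F z := by
    refine integral_congr_ae (ae_restrict_of_ae ?_)
    filter_upwards [compl_mem_ae_iff.2 (measure_singleton (0 : ℂ))] with z hz
    rw [hF _ _ hz]
    push_cast
    rw [mul_div_cancel₀ _ hk', Complex.exp_pi_mul_I, neg_one_mul]
  rw [h2, integral_neg] at h
  exact self_eq_neg.1 h.symm

theorem setIntegral_ball_norm_pow {R : ℝ} (hR : 0 ≤ R) (n : ℕ) :
    ∫ z in ball (0 : ℂ) R, ((‖z‖ : ℂ)) ^ n = 2 * Real.pi * R ^ (n + 2) / (n + 2) := by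
  have h := integral_fun_norm_addHaar (volume : Measure ℂ)
    (fun r => (Set.Iio R).indicator (fun r : ℝ => (r : ℂ) ^ n) r)
  have e : ∀ z : ℂ, (Set.Iio R).indicator (fun r : ℝ => (r : ℂ) ^ n) ‖z‖
      = (ball (0 : ℂ) R).indicator (fun z => (‖z‖ : ℂ) ^ n) z := by
    intro z
    by_cases hz : ‖z‖ < R <;> simp [hz]
  simp only [e] at h
  rw [integral_indicator measurableSet_ball] at h
  rw [h]
  have e2 : ∀ y : ℝ, y ^ (Module.finrank ℝ ℂ - 1) • (Set.Iio R).indicator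
      (fun r : ℝ => (r : ℂ) ^ n) y = (Set.Iio R).indicator (fun r : ℝ => ((r ^ (n + 1) : ℝ) : ℂ)) y := by
    intro y
    by_cases hy : y < R
    · simp [hy, Complex.finrank_real_complex]; ring
    · simp [hy]
  simp only [e2]
  rw [setIntegral_indicator measurableSet_Iio, Set.Ioi_inter_Iio, ← integral_Ioc_eq_integral_Ioo,
    ← intervalIntegral.integral_of_le hR, intervalIntegral.integral_ofReal, integral_pow]
  simp [Complex.finrank_real_complex, Measure.real, Complex.volume_ball]
  ring

theorem setIntegral_ball_monomial {R : ℝ} (hR : 0 ≤ R) (a b : ℕ) :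
    ∫ z in ball (0 : ℂ) R, z ^ a * conj z ^ b =
      if a = b then (Real.pi : ℂ) * R ^ (2 * a + 2) / (a + 1) else 0 := by
  split_ifs with h
  · subst h
    have e : ∀ z : ℂ, z ^ a * conj z ^ a = (‖z‖ : ℂ) ^ (2 * a) := by
      intro z
      rw [← mul_pow, Complex.mul_conj', pow_mul]
    simp only [e]
    rw [setIntegral_ball_norm_pow hR]
    have : (a : ℂ) + 1 ≠ 0 := Nat.cast_add_one_ne_zero a
    have h2 : (2 * a : ℂ) + 2 ≠ 0 := by
      rw [show (2 * a : ℂ) + 2 = 2 * (a + 1) by ring]; simp [this]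
    push_cast
    field_simp
  · refine setIntegral_ball_eq_zero_of_homogeneous (k := (a : ℤ) - b) (by omega) fun θ z _ => ?_
    rw [map_mul, ← Complex.exp_conj, mul_pow, mul_pow, ← Complex.exp_nat_mul, ← Complex.exp_nat_mul]
    have : Complex.exp (((a : ℤ) - b : ℤ) * θ * Complex.I) =
        Complex.exp (a * (θ * Complex.I)) * Complex.exp (b * conj (θ * Complex.I)) := by
      rw [← Complex.exp_add]
      congr 1
      simp
      ring
    rw [this]; ring

theorem integral_diskMeasure_monomial (a b : ℕ) :
    ∫ z, z ^ a * conj z ^ b ∂diskMeasure = if a = b then ((a : ℂ) + 1)⁻¹ else 0 := by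
  rw [integral_diskMeasure, setIntegral_ball_monomial zero_le_one]
  have : (Real.pi : ℂ) ≠ 0 := by simp [Real.pi_ne_zero]
  split_ifs
  · simp; field_simp
  · simp

/-! ### Moments of integrable functions on the disk. -/

theorem ae_diskMeasure_norm_lt_one : ∀ᵐ z ∂diskMeasure, ‖z‖ < 1 := by
  filter_upwards [ae_mem_ball_diskMeasure] with z hz
  simpa using hz

theorem ae_diskMeasure_ne_zero : ∀ᵐ z ∂diskMeasure, z ≠ 0 :=
  ae_diskMeasure_iff.2 (ae_restrict_of_ae (compl_mem_ae_iff.2 (measure_singleton (0 : ℂ))))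

/-- The Jacobian `r` cancels the singularity. This is what admits the weight `f / z̄` needed on the
diagonal of index `3`. -/
theorem integrable_inv_norm_diskMeasure : Integrable (fun z : ℂ => ‖z‖⁻¹) diskMeasure := by
  have h0 : (ENNReal.ofReal Real.pi)⁻¹ ≠ ∞ := by simpa using Real.pi_pos
  refine Integrable.smul_measure ?_ h0
  refine (integrableOn_fun_norm_addHaar (volume : Measure ℂ) (f := fun r => r⁻¹) (r := 1)).2 ?_
  rw [Complex.finrank_real_complex]
  refine (integrableOn_const (C := (1 : ℝ)) (by simp)).congr_fun (fun y hy => ?_) measurableSet_Ioo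
  have := hy.1.ne'
  simp [this]

theorem MeasureTheory.Integrable.bounded_mul_diskMeasure {w h : ℂ → ℂ} (hw : Integrable w diskMeasure)
    (hm : AEStronglyMeasurable h diskMeasure) {B : ℝ} (hB : ∀ z, ‖z‖ < 1 → ‖h z‖ ≤ B) :
    Integrable (fun z => h z * w z) diskMeasure :=
  hw.bdd_mul hm (ae_diskMeasure_norm_lt_one.mono hB)

/-- The moments `∫ f z^a z̄^b dA`. -/
noncomputable def moment (f : ℂ → ℂ) (a b : ℕ) : ℂ :=
  ∫ z, f z * (z ^ a * conj z ^ b) ∂diskMeasure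

theorem norm_monomial_le_one {z : ℂ} (hz : ‖z‖ < 1) (a b : ℕ) : ‖z ^ a * conj z ^ b‖ ≤ 1 := by
  rw [norm_mul, norm_pow, norm_pow, RCLike.norm_conj, ← pow_add]
  exact pow_le_one₀ (norm_nonneg z) hz.le

theorem integrable_mul_monomial {f : ℂ → ℂ} (hf : Integrable f diskMeasure) (a b : ℕ) :
    Integrable (fun z => f z * (z ^ a * conj z ^ b)) diskMeasure := by
  have : Continuous fun z : ℂ => z ^ a * conj z ^ b := by fun_prop
  simp_rw [mul_comm (f _)]
  exact hf.bounded_mul_diskMeasure this.aestronglyMeasurable fun z hz => norm_monomial_le_one hz a b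

theorem moment_one (a b : ℕ) : moment (fun _ => 1) a b = if a = b then ((a : ℂ) + 1)⁻¹ else 0 := by
  simp only [moment, one_mul, integral_diskMeasure_monomial]

theorem moment_mul_monomial (f : ℂ → ℂ) (p q a b : ℕ) :
    moment (fun z => f z * (z ^ p * conj z ^ q)) a b = moment f (p + a) (q + b) := by
  simp only [moment]
  congr 1; ext z; ring

theorem moment_sub {f g : ℂ → ℂ} (hf : Integrable f diskMeasure) (hg : Integrable g diskMeasure)
    (a b : ℕ) : moment (fun z => f z - g z) a b = moment f a b - moment g a b := by
  simp only [moment, sub_mul]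
  exact integral_sub (integrable_mul_monomial hf a b) (integrable_mul_monomial hg a b)

theorem moment_const_mul (c : ℂ) (f : ℂ → ℂ) (a b : ℕ) :
    moment (fun z => c * f z) a b = c * moment f a b := by
  simp only [moment, mul_assoc, integral_const_mul]

/-! ### Polynomial approximation in `ρ = |z|⁴`. -/

/-- The functional `p ↦ ∫ p(ρ) w₁ + ρ p'(ρ) w₂`, with `ρ = ‖z‖⁴`, is determined by its values on
monomials. -/
theorem integral_polynomial_norm_pow_four {w₁ w₂ : ℂ → ℂ} (h₁ : Integrable w₁ diskMeasure)
    (h₂ : Integrable w₂ diskMeasure)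
    (h : ∀ j : ℕ, 1 ≤ j → ∫ z, ((‖z‖ : ℂ) ^ 4) ^ j * w₁ z ∂diskMeasure
      + j * ∫ z, ((‖z‖ : ℂ) ^ 4) ^ j * w₂ z ∂diskMeasure = 0) (p : Polynomial ℂ) :
    ∫ z, p.eval ((‖z‖ : ℂ) ^ 4) * w₁ z ∂diskMeasure +
      ∫ z, ((‖z‖ : ℂ) ^ 4 * p.derivative.eval ((‖z‖ : ℂ) ^ 4)) * w₂ z ∂diskMeasure
      = p.coeff 0 * ∫ z, w₁ z ∂diskMeasure := by
  have hi : ∀ (q : Polynomial ℂ) {w : ℂ → ℂ}, Integrable w diskMeasure →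
      Integrable (fun z => q.eval ((‖z‖ : ℂ) ^ 4) * w z) diskMeasure := by
    intro q w hw
    have hc : Continuous fun z : ℂ => q.eval ((‖z‖ : ℂ) ^ 4) :=
      q.continuous.comp (by fun_prop)
    obtain ⟨B, hB⟩ := (isCompact_closedBall (0 : ℂ) 1).exists_bound_of_continuousOn hc.continuousOn
    exact hw.bounded_mul_diskMeasure hc.aestronglyMeasurable fun z hz => hB z (by simpa using hz.le)
  have hi' : ∀ (q : Polynomial ℂ) {w : ℂ → ℂ}, Integrable w diskMeasure →
      Integrable (fun z => ((‖z‖ : ℂ) ^ 4 * q.eval ((‖z‖ : ℂ) ^ 4)) * w z) diskMeasure := by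
    intro q w hw
    refine (hi (Polynomial.X * q) hw).congr (Eventually.of_forall fun z => ?_)
    dsimp only
    rw [Polynomial.eval_mul, Polynomial.eval_X]
  induction p using Polynomial.induction_on' with
  | add p q hp hq =>
    simp only [Polynomial.eval_add, Polynomial.derivative_add, Polynomial.coeff_add, mul_add, add_mul]
    rw [integral_add (hi p h₁) (hi q h₁), integral_add (hi' _ h₂) (hi' _ h₂), ← hp, ← hq]
    ring
  | monomial n a =>
    rcases Nat.eq_zero_or_pos n with rfl | hn
    · simp [integral_const_mul]
    · have := h n hn
      simp only [Polynomial.eval_monomial, Polynomial.derivative_monomial, mul_assoc, integral_const_mul]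
      rw [Polynomial.coeff_monomial_of_ne _ hn.ne, zero_mul]
      have e : ∀ z : ℂ, (‖z‖ : ℂ) ^ 4 * (a * (n * (((‖z‖ : ℂ) ^ 4) ^ (n - 1) * w₂ z)))
          = a * (n * (((‖z‖ : ℂ) ^ 4) ^ n * w₂ z)) := by
        intro z
        obtain ⟨m, rfl⟩ : ∃ m, n = m + 1 := ⟨n - 1, by omega⟩
        simp only [Nat.add_sub_cancel]
        ring
      simp only [e, integral_const_mul, ← mul_add, this, mul_zero]

/-- From `x ∑_{i ≤ m} (1 - x)^i = 1 - (1 - x)^(m+1) ≤ 1`, as each of the `m + 1` summands is at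
least `(1 - x)^m`. It provides the domination for the derivative term below. -/
theorem add_one_mul_mul_one_sub_pow_le_one {x : ℝ} (h0 : 0 ≤ x) (h1 : x ≤ 1) (m : ℕ) :
    (m + 1) * x * (1 - x) ^ m ≤ 1 := by
  have hs := mul_neg_geom_sum (1 - x) (m + 1)
  have hle : ∑ _i ∈ Finset.range (m + 1), (1 - x) ^ m ≤ ∑ i ∈ Finset.range (m + 1), (1 - x) ^ i :=
    Finset.sum_le_sum fun i hi => pow_le_pow_of_le_one (by linarith) (by linarith)
      (Nat.lt_succ_iff.1 (Finset.mem_range.1 hi))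
  rw [Finset.sum_const, Finset.card_range, nsmul_eq_mul] at hle
  push_cast at hle
  have := mul_le_mul_of_nonneg_left hle h0
  have hp : 0 ≤ (1 - x) ^ (m + 1) := pow_nonneg (by linarith) _
  rw [sub_sub_cancel] at hs
  nlinarith

/-- If the sequence `j ↦ ∫ ρ^j w₁ + j ∫ ρ^j w₂`, with `ρ = ‖z‖⁴`, vanishes for `j ≥ 1`, then it
vanishes at `j = 0`. -/
theorem integral_eq_zero_of_moments_eq_zero {w₁ w₂ : ℂ → ℂ} (h₁ : Integrable w₁ diskMeasure)
    (h₂ : Integrable w₂ diskMeasure)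
    (h : ∀ j : ℕ, 1 ≤ j → ∫ z, ((‖z‖ : ℂ) ^ 4) ^ j * w₁ z ∂diskMeasure
      + j * ∫ z, ((‖z‖ : ℂ) ^ 4) ^ j * w₂ z ∂diskMeasure = 0) :
    ∫ z, w₁ z ∂diskMeasure = 0 := by
  -- Test polynomial `p = (1 - X)^(m+1)`: `p(0) = 1`, while `p(ρ)` and `ρ p'(ρ)` tend boundedly to
  -- `0` for `0 < ρ < 1`, so the left side tends to `0`.
  have key : ∀ m : ℕ, ∫ z, (1 - (‖z‖ : ℂ) ^ 4) ^ (m + 1) * w₁ z ∂diskMeasure -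
      ∫ z, ((m + 1) * (‖z‖ : ℂ) ^ 4 * (1 - (‖z‖ : ℂ) ^ 4) ^ m) * w₂ z ∂diskMeasure
      = ∫ z, w₁ z ∂diskMeasure := by
    intro m
    have := integral_polynomial_norm_pow_four h₁ h₂ h ((1 - Polynomial.X) ^ (m + 1))
    rw [Polynomial.coeff_zero_eq_eval_zero] at this
    simp [Polynomial.derivative_pow] at this
    rw [← this, sub_eq_add_neg, ← integral_neg]
    congr 2
    ext z
    ring
  have hnorm : ∀ᵐ z ∂diskMeasure, 0 < ‖z‖ ^ 4 ∧ ‖z‖ ^ 4 < 1 := by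
    filter_upwards [ae_diskMeasure_norm_lt_one, ae_diskMeasure_ne_zero] with z hz hz0
    have := norm_pos_iff.2 hz0
    exact ⟨by positivity, pow_lt_one₀ this.le hz (by norm_num)⟩
  have t1 : Tendsto (fun m : ℕ => ∫ z, (1 - (‖z‖ : ℂ) ^ 4) ^ (m + 1) * w₁ z ∂diskMeasure) atTop
      (𝓝 0) := by
    rw [← integral_zero ℂ ℂ (μ := diskMeasure)]
    refine tendsto_integral_of_dominated_convergence (fun z => ‖w₁ z‖) (fun m => ?_) h₁.norm
      (fun m => ?_) ?_
    · exact (Continuous.aestronglyMeasurable (by fun_prop)).mul h₁.1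
    · filter_upwards [hnorm] with z hz
      rw [norm_mul, norm_pow]
      refine mul_le_of_le_one_left (norm_nonneg _) (pow_le_one₀ (norm_nonneg _) ?_)
      rw [show (1 - (‖z‖ : ℂ) ^ 4) = ((1 - ‖z‖ ^ 4 : ℝ) : ℂ) by push_cast; ring, Complex.norm_real,
        Real.norm_of_nonneg (by linarith)]
      linarith
    · filter_upwards [hnorm] with z hz
      rw [show (1 - (‖z‖ : ℂ) ^ 4) = ((1 - ‖z‖ ^ 4 : ℝ) : ℂ) by push_cast; ring]
      rw [show (0 : ℂ) = 0 * w₁ z by ring]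
      refine Tendsto.mul_const _ ?_
      refine (tendsto_pow_atTop_nhds_zero_of_norm_lt_one ?_).comp (tendsto_add_atTop_nat 1)
      rw [Complex.norm_real, Real.norm_of_nonneg (by linarith)]
      linarith
  have t2 : Tendsto (fun m : ℕ => ∫ z, ((m + 1) * (‖z‖ : ℂ) ^ 4 * (1 - (‖z‖ : ℂ) ^ 4) ^ m) * w₂ z
      ∂diskMeasure) atTop (𝓝 0) := by
    have e : ∀ (m : ℕ) (z : ℂ), (m + 1) * (‖z‖ : ℂ) ^ 4 * (1 - (‖z‖ : ℂ) ^ 4) ^ m =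
        (((m + 1) * ‖z‖ ^ 4 * (1 - ‖z‖ ^ 4) ^ m : ℝ) : ℂ) := by
      intro m z; push_cast; ring
    rw [← integral_zero ℂ ℂ (μ := diskMeasure)]
    refine tendsto_integral_of_dominated_convergence (fun z => ‖w₂ z‖) (fun m => ?_) h₂.norm
      (fun m => ?_) ?_
    · exact (Continuous.aestronglyMeasurable (by fun_prop)).mul h₂.1
    · filter_upwards [hnorm] with z hz
      rw [norm_mul, e, Complex.norm_real, Real.norm_of_nonneg]
      · exact mul_le_of_le_one_left (norm_nonneg _)
          (add_one_mul_mul_one_sub_pow_le_one hz.1.le hz.2.le m)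
      · have : 0 ≤ 1 - ‖z‖ ^ 4 := by linarith
        positivity
    · filter_upwards [hnorm] with z hz
      simp only [e]
      rw [show (0 : ℂ) = ((0 : ℝ) : ℂ) * w₂ z by simp]
      refine Tendsto.mul_const _ ((Complex.continuous_ofReal.tendsto 0).comp ?_)
      have a0 : |1 - ‖z‖ ^ 4| < 1 := by rw [abs_lt]; constructor <;> linarith
      have a1 := tendsto_self_mul_const_pow_of_abs_lt_one a0
      have a2 := tendsto_pow_atTop_nhds_zero_of_abs_lt_one a0
      have a3 := (a1.add a2).const_mul (‖z‖ ^ 4)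
      rw [add_zero, mul_zero] at a3
      refine a3.congr fun m => ?_
      ring
  have t := t1.sub t2
  simp only [key, sub_zero] at t
  exact tendsto_nhds_unique tendsto_const_nhds t

theorem integral_norm_sq_eq_zero_of_moments_eq_zero {w : ℂ → ℂ} (hw : Integrable w diskMeasure)
    (h : ∀ j : ℕ, ∫ z, ((‖z‖ : ℂ) ^ 4) ^ j * w z ∂diskMeasure = 0) :
    ∫ z, (‖z‖ : ℂ) ^ 2 * w z ∂diskMeasure = 0 := by
  have h0 : ∫ z, w z ∂diskMeasure = 0 := by simpa using h 0
  have hp : ∀ p : Polynomial ℝ, ∫ z, ((p.eval (‖z‖ ^ 4) : ℝ) : ℂ) * w z ∂diskMeasure = 0 := by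
    intro p
    have := integral_polynomial_norm_pow_four (w₂ := fun _ => 0) hw (integrable_zero ℂ ℂ diskMeasure)
      (fun j _ => by simp [h j]) (p.map (algebraMap ℝ ℂ))
    simp only [mul_zero, integral_zero, add_zero, h0] at this
    rw [← this]
    congr 1; ext z
    rw [show ((‖z‖ : ℂ) ^ 4) = algebraMap ℝ ℂ (‖z‖ ^ 4) by simp, Polynomial.eval_map_apply]
    rfl
  have hint : ∀ {g : ℝ → ℝ}, Continuous g →
      Integrable (fun z => ((g ‖z‖ : ℝ) : ℂ) * w z) diskMeasure := by
    intro g hg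
    have hc : Continuous fun z : ℂ => ((g ‖z‖ : ℝ) : ℂ) := by fun_prop
    obtain ⟨B, hB⟩ := (isCompact_closedBall (0 : ℂ) 1).exists_bound_of_continuousOn hc.continuousOn
    exact hw.bounded_mul_diskMeasure hc.aestronglyMeasurable fun z hz => hB z (by simpa using hz.le)
  rw [← norm_le_zero_iff]
  have hb : ∀ ε > 0, ‖∫ z, (‖z‖ : ℂ) ^ 2 * w z ∂diskMeasure‖ ≤ ε * ∫ z, ‖w z‖ ∂diskMeasure := by
    intro ε hε
    -- `|z|² = √ρ` is a uniform limit of polynomials in `ρ`, each of which integrates to zero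
    -- against `w`.
    obtain ⟨p, hp'⟩ := exists_polynomial_near_of_continuousOn 0 1 Real.sqrt
      Real.continuous_sqrt.continuousOn ε hε
    have e : ∫ z, (‖z‖ : ℂ) ^ 2 * w z ∂diskMeasure =
        ∫ z, ((‖z‖ : ℂ) ^ 2 * w z - ((p.eval (‖z‖ ^ 4) : ℝ) : ℂ) * w z) ∂diskMeasure := by
      rw [integral_sub _ (hint (g := fun r => p.eval (r ^ 4))
        (p.continuous.comp (continuous_pow 4))), hp, sub_zero]
      simpa using hint (continuous_pow 2)
    rw [e, ← integral_const_mul]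
    refine norm_integral_le_of_norm_le (hw.norm.const_mul ε) ?_
    filter_upwards [ae_diskMeasure_norm_lt_one] with z hz
    rw [← sub_mul, norm_mul]
    gcongr
    have := hp' (‖z‖ ^ 4) ⟨by positivity, pow_le_one₀ (norm_nonneg z) hz.le⟩
    rw [show ‖z‖ ^ 4 = (‖z‖ ^ 2) ^ 2 by ring, Real.sqrt_sq (by positivity)] at this
    rw [← Complex.ofReal_pow, ← Complex.ofReal_sub, Complex.norm_real, Real.norm_eq_abs, abs_sub_comm,
      show ‖z‖ ^ 4 = (‖z‖ ^ 2) ^ 2 by ring]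
    exact this.le
  have ht : Tendsto (fun ε : ℝ => ε * ∫ z, ‖w z‖ ∂diskMeasure) (𝓝[>] 0) (𝓝 0) := by
    have := ((continuous_mul_const (∫ z, ‖w z‖ ∂diskMeasure)).tendsto 0)
    rw [zero_mul] at this
    exact this.mono_left nhdsWithin_le_nhds
  exact ge_of_tendsto ht (eventually_nhdsWithin_of_forall hb)

/-- If the moments `(a + 2j, b + 2j)` vanish for all `j`, so does the moment `(a + 1, b + 1)`. -/
theorem moment_add_one_eq_zero {f : ℂ → ℂ} (hf : Integrable f diskMeasure) {a b : ℕ}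
    (h : ∀ j : ℕ, moment f (a + 2 * j) (b + 2 * j) = 0) : moment f (a + 1) (b + 1) = 0 := by
  have hn : ∀ z : ℂ, (‖z‖ : ℂ) ^ 2 = z * conj z := fun z => (Complex.mul_conj' z).symm
  rw [← integral_norm_sq_eq_zero_of_moments_eq_zero (integrable_mul_monomial hf a b) fun j => ?_]
  · rw [moment]
    congr 1; ext z
    rw [hn]
    ring
  · rw [← h j, moment]
    congr 1; ext z
    rw [show (‖z‖ : ℂ) ^ 4 = ((‖z‖ : ℂ) ^ 2) ^ 2 by ring, hn]
    ring

/-! ### The recurrence along diagonals. -/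

/-- The coefficient `(n - 1) / (n + 1)` of `T_{z̄²} z^n = c_n z^{n-2}` (and `0` for `n ≤ 1`). -/
noncomputable def conjSqCoeff (n : ℕ) : ℂ := ((n - 1 : ℕ) : ℂ) / (n + 1)

theorem conjSqCoeff_zero : conjSqCoeff 0 = 0 := by simp [conjSqCoeff]

theorem conjSqCoeff_one : conjSqCoeff 1 = 0 := by simp [conjSqCoeff]

theorem conjSqCoeff_add_one (n : ℕ) : conjSqCoeff (n + 1) = n / (n + 2) := by
  simp only [conjSqCoeff, Nat.add_sub_cancel]
  push_cast
  ring

theorem conjSqCoeff_add_two (n : ℕ) : conjSqCoeff (n + 2) = (n + 1) / (n + 3) := by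
  rw [show n + 2 = (n + 1) + 1 by rfl, conjSqCoeff_add_one]
  push_cast
  ring

/-- The relations satisfied by the moments of a symbol whose Toeplitz operator commutes with
`T_{z² + z̄²}`. -/
def CommutationRelations (M : ℕ → ℕ → ℂ) : Prop :=
  ∀ n m, M (n + 2) m + conjSqCoeff n * M (n - 2) m = M n (m + 2) + conjSqCoeff m * M n (m - 2)

/-- The entries of `M` on the `k`-th diagonal vanish. -/
def DiagonalVanishes (M : ℕ → ℕ → ℂ) (k : ℤ) : Prop :=
  ∀ a b : ℕ, (b : ℤ) - a = k → M a b = 0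

theorem diagonalVanishes_natCast {M : ℕ → ℕ → ℂ} {k : ℕ} :
    DiagonalVanishes M k ↔ ∀ a, M a (a + k) = 0 :=
  ⟨fun h a => h a _ (by push_cast; ring), fun h a b hab => by
    obtain rfl : b = a + k := by omega
    exact h a⟩

/-- With diagonal `k + 4` gone, the relation reads `M (n+2) b = c_b * M n (b-2)`. As `k ≤ -2`, every
entry has first index at least `2`, and the descent ends because `c_0 = c_1 = 0`. -/
theorem DiagonalVanishes.of_le_neg_two {M : ℕ → ℕ → ℂ} (hM : CommutationRelations M) {k : ℤ}
    (hk : k ≤ -2) (h : DiagonalVanishes M (k + 4)) : DiagonalVanishes M k := by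
  intro a b hab
  induction b using Nat.strong_induction_on generalizing a with
  | _ b ih =>
    obtain ⟨n, rfl⟩ : ∃ n, a = n + 2 := ⟨a - 2, by omega⟩
    have h1 := hM n b
    have e1 : conjSqCoeff n * M (n - 2) b = 0 := by
      rcases n with - | - | n
      · simp [conjSqCoeff_zero]
      · simp [conjSqCoeff_one]
      · rw [h _ _ (by push_cast at hab ⊢; omega), mul_zero]
    have e2 : conjSqCoeff b * M n (b - 2) = 0 := by
      rcases b with - | - | b
      · simp [conjSqCoeff_zero]
      · simp [conjSqCoeff_one]
      · rw [ih (b + 1 + 1 - 2) (by omega) n (by push_cast at hab ⊢; omega), mul_zero]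
    rw [e1, e2, h n (b + 2) (by push_cast at hab ⊢; omega)] at h1
    simpa using h1

/-- The two-step recursion along a diagonal of nonnegative index. -/
theorem CommutationRelations.diagonal_succ {M : ℕ → ℕ → ℂ} (hM : CommutationRelations M) {k : ℕ}
    (h : DiagonalVanishes M (k + 4)) (n : ℕ) :
    (n + k + 3) * M (n + 2) (n + 2 + k) = (n + k + 1) * M n (n + k) := by
  have h1 := hM n (n + k + 2)
  have e1 : conjSqCoeff n * M (n - 2) (n + k + 2) = 0 := by
    rcases n with - | - | n
    · simp [conjSqCoeff_zero]
    · simp [conjSqCoeff_one]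
    · rw [h _ _ (by push_cast; omega), mul_zero]
  rw [e1, h n _ (by push_cast; ring), conjSqCoeff_add_two, Nat.add_sub_cancel] at h1
  rw [show n + 2 + k = n + k + 2 by ring]
  rw [add_zero, zero_add] at h1
  rw [h1]
  have : (n : ℂ) + k + 3 ≠ 0 := by exact_mod_cast (by omega : n + k + 3 ≠ 0)
  push_cast
  field_simp

theorem CommutationRelations.diagonal_even {M : ℕ → ℕ → ℂ} (hM : CommutationRelations M) {k : ℕ}
    (h : DiagonalVanishes M (k + 4)) (j : ℕ) :
    (2 * j + k + 1) * M (2 * j) (2 * j + k) = (k + 1) * M 0 k := by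
  induction j with
  | zero => simp
  | succ j ih =>
    rw [← ih]
    have := hM.diagonal_succ h (2 * j)
    push_cast at this ⊢
    rw [← this, show 2 * (j + 1) = 2 * j + 2 by ring]
    ring

theorem CommutationRelations.diagonal_odd {M : ℕ → ℕ → ℂ} (hM : CommutationRelations M) {k : ℕ}
    (h : DiagonalVanishes M (k + 4)) (j : ℕ) :
    (2 * j + k + 2) * M (2 * j + 1) (2 * j + 1 + k) = (k + 2) * M 1 (1 + k) := by
  induction j with
  | zero => simp
  | succ j ih =>
    rw [← ih]
    have := hM.diagonal_succ h (2 * j + 1)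
    push_cast at this ⊢
    rw [show 2 * (j + 1) + 1 = 2 * j + 1 + 2 by ring]
    linear_combination this

/-- A diagonal of nonnegative index is determined by its first entry. -/
theorem DiagonalVanishes.of_first_eq_zero {f : ℂ → ℂ} (hf : Integrable f diskMeasure)
    (hM : CommutationRelations (moment f)) {k : ℕ} (h : DiagonalVanishes (moment f) (k + 4))
    (h0 : moment f 0 k = 0) : DiagonalVanishes (moment f) k := by
  have he : ∀ j : ℕ, moment f (2 * j) (2 * j + k) = 0 := by
    intro j
    have := hM.diagonal_even h j
    rw [h0, mul_zero] at this
    exact (mul_eq_zero.1 this).resolve_left (by exact_mod_cast (by omega : 2 * j + k + 1 ≠ 0))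
  -- The recurrence does not link even and odd entries; the integral representation does.
  have h1 : moment f 1 (1 + k) = 0 := by
    have := moment_add_one_eq_zero hf (a := 0) (b := k) fun j => by
      rw [zero_add, add_comm]; exact he j
    rwa [zero_add, add_comm] at this
  rw [diagonalVanishes_natCast]
  intro a
  obtain ⟨j, rfl | rfl⟩ := a.even_or_odd'
  · exact he j
  · have := hM.diagonal_odd h j
    rw [h1, mul_zero] at this
    exact (mul_eq_zero.1 this).resolve_left (by exact_mod_cast (by omega : 2 * j + k + 2 ≠ 0))

/-- The recurrence kills the entries `(2j+2, 2j+1)`, since `c_1 = 0`, but leaves `M 1 0` free.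
Approximation gives `M 3 2 = 0`, and `M 3 2 = c_2 * M 1 0` with `c_2 = 1/3 ≠ 0` then removes `M 1
0`. -/
theorem DiagonalVanishes.neg_one {f : ℂ → ℂ} (hf : Integrable f diskMeasure)
    (hM : CommutationRelations (moment f)) (h : DiagonalVanishes (moment f) 3) :
    DiagonalVanishes (moment f) (-1) := by
  have hrec : ∀ n : ℕ, moment f (n + 2) (n + 1) = conjSqCoeff (n + 1) * moment f n (n - 1) := by
    intro n
    have h1 := hM n (n + 1)
    have e1 : conjSqCoeff n * moment f (n - 2) (n + 1) = 0 := by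
      rcases n with - | - | n
      · simp [conjSqCoeff_zero]
      · simp [conjSqCoeff_one]
      · rw [h _ _ (by push_cast; omega), mul_zero]
    rw [e1, h n _ (by push_cast; ring)] at h1
    simpa using h1
  have he : ∀ j : ℕ, moment f (2 + 2 * j) (1 + 2 * j) = 0 := by
    intro j
    induction j with
    | zero => simpa [conjSqCoeff_one] using hrec 0
    | succ j ih =>
      have := hrec (2 + 2 * j)
      rw [show 2 + 2 * j - 1 = 1 + 2 * j by omega, ih, mul_zero] at this
      rw [← this]
      congr 1; ring
  have h32 : moment f 3 2 = 0 := moment_add_one_eq_zero hf (a := 2) (b := 1) he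
  have h10 : moment f 1 0 = 0 := by
    have := hrec 1
    rw [h32, conjSqCoeff_add_one] at this
    simpa [show (1 : ℂ) + 2 ≠ 0 by norm_num] using this
  have ho : ∀ j : ℕ, moment f (2 * j + 1) (2 * j) = 0 := by
    intro j
    induction j with
    | zero => simpa using h10
    | succ j ih =>
      have := hrec (2 * j + 1)
      rw [Nat.add_sub_cancel, ih, mul_zero] at this
      rw [← this]
      congr 1
  intro a b hab
  obtain rfl : a = b + 1 := by omega
  obtain ⟨j, rfl | rfl⟩ := b.even_or_odd'
  · exact ho j
  · rw [← he j]; congr 1 <;> ring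

/-! ### The diagonals of index `k ≥ 3` and `k = 1`. -/

theorem MeasureTheory.MemLp.exists_norm_le_diskMeasure {f : ℂ → ℂ} (hf : MemLp f ∞ diskMeasure) :
    ∃ B : ℝ, 0 ≤ B ∧ ∀ᵐ z ∂diskMeasure, ‖f z‖ ≤ B := by
  refine ⟨(eLpNorm f ∞ diskMeasure).toReal, ENNReal.toReal_nonneg, ?_⟩
  have h := hf.eLpNorm_ne_top
  rw [eLpNorm_exponent_top] at h ⊢
  filter_upwards [ae_le_eLpNormEssSup (f := f) (μ := diskMeasure)] with z hz
  rw [← toReal_enorm]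
  exact ENNReal.toReal_mono h hz

theorem MeasureTheory.MemLp.integrable_diskMeasure {f : ℂ → ℂ} (hf : MemLp f ∞ diskMeasure) :
    Integrable f diskMeasure :=
  hf.integrable le_top

theorem integral_norm_pow_diskMeasure (a : ℕ) :
    ∫ z, (‖z‖ : ℂ) ^ (2 * a) ∂diskMeasure = ((a : ℂ) + 1)⁻¹ := by
  have := integral_diskMeasure_monomial a a
  rw [if_pos rfl] at this
  rw [← this]
  congr 1; ext z
  rw [← mul_pow, Complex.mul_conj', pow_mul]

theorem integrable_norm_pow_diskMeasure (a : ℕ) :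
    Integrable (fun z : ℂ => (‖z‖ : ℂ) ^ a) diskMeasure := by
  have hc : Continuous fun z : ℂ => (‖z‖ : ℂ) ^ a := by fun_prop
  simpa using (integrable_const (1 : ℂ)).bounded_mul_diskMeasure (B := 1) hc.aestronglyMeasurable
    fun z hz => by
      rw [norm_pow, Complex.norm_real, norm_norm]
      exact pow_le_one₀ (norm_nonneg z) hz.le

theorem integral_sub_sub_add {α : Type*} [MeasurableSpace α] {μ : Measure α} {F₁ F₂ F₃ F₄ : α → ℂ}
    (h₁ : Integrable F₁ μ) (h₂ : Integrable F₂ μ) (h₃ : Integrable F₃ μ) (h₄ : Integrable F₄ μ) :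
    ∫ z, F₁ z - F₂ z - F₃ z + F₄ z ∂μ = ∫ z, F₁ z ∂μ - ∫ z, F₂ z ∂μ - ∫ z, F₃ z ∂μ + ∫ z, F₄ z ∂μ := by
  have h₁₂ : Integrable (fun z => F₁ z - F₂ z) μ := h₁.sub h₂
  have h₁₂₃ : Integrable (fun z => F₁ z - F₂ z - F₃ z) μ := h₁₂.sub h₃
  rw [integral_add h₁₂₃ h₄, integral_sub h₁₂ h₃, integral_sub h₁ h₂]

/-- With `k = l + 3`, the even entries are `C / (2j + l + 4)`; substituted in the relation, they
give an identity on diagonal `l - 1`. It is uniform in `j` except for an extra `-C` at `j = 0`,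
which the integral representation rules out. -/
theorem DiagonalVanishes.of_three_le {f : ℂ → ℂ} (hf : MemLp f ∞ diskMeasure)
    (hM : CommutationRelations (moment f)) {k : ℕ} (hk : 3 ≤ k)
    (h : DiagonalVanishes (moment f) (k + 4)) : DiagonalVanishes (moment f) k := by
  refine h.of_first_eq_zero hf.integrable_diskMeasure hM ?_
  obtain ⟨l, rfl⟩ : ∃ l, k = l + 3 := ⟨k - 3, by omega⟩
  set C : ℂ := (l + 4) * moment f 0 (l + 3) with hC
  have hl : (l : ℂ) + 4 ≠ 0 := by exact_mod_cast (by omega : l + 4 ≠ 0)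
  have hdiag : ∀ j : ℕ, moment f (2 * j) (2 * j + l + 3) = C / (2 * j + l + 4) := by
    intro j
    have := hM.diagonal_even h j
    have hj : (2 * j : ℂ) + l + 4 ≠ 0 := by exact_mod_cast (by omega : 2 * j + l + 4 ≠ 0)
    push_cast at this
    rw [eq_div_iff hj, hC, add_assoc (2 * j)]
    linear_combination this
  -- The defect `-C` arises because `c_0 = 0`, whereas `(n - 1) / (n + 1)` at `n = 0` would be `-1`.
  have hrel : ∀ j : ℕ, (2 * j + l + 2) * moment f (2 * j + 2) (2 * j + l + 1)
      - (2 * j + l) * moment f (2 * j) (2 * j + l - 1)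
      - 2 * C * (2 * j + 1 : ℂ)⁻¹ + 2 * C * (2 * j + l + 4 : ℂ)⁻¹ = if j = 0 then -C else 0 := by
    intro j
    have h1 := hM (2 * j) (2 * j + l + 1)
    have hj1 : (2 * j : ℂ) + l + 4 ≠ 0 := by exact_mod_cast (by omega : 2 * j + l + 4 ≠ 0)
    have hj2 : (2 * j : ℂ) + l + 2 ≠ 0 := by exact_mod_cast (by omega : 2 * j + l + 2 ≠ 0)
    have hj3 : (2 * j : ℂ) + 1 ≠ 0 := by exact_mod_cast (by omega : 2 * j + 1 ≠ 0)
    rw [conjSqCoeff_add_one, show 2 * j + l + 1 + 2 = 2 * j + l + 3 by ring, hdiag,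
      show 2 * j + l + 1 - 2 = 2 * j + l - 1 by omega] at h1
    push_cast at h1
    split_ifs with hj
    · subst hj
      simp [conjSqCoeff_zero] at h1 hj1 hj2 ⊢
      rw [h1]
      field_simp
      ring
    · obtain ⟨i, rfl⟩ : ∃ i, j = i + 1 := ⟨j - 1, by omega⟩
      have e := hdiag i
      rw [show 2 * (i + 1) = 2 * i + 2 by ring, conjSqCoeff_add_two, Nat.add_sub_cancel,
        show 2 * i + 2 + l + 1 = 2 * i + l + 3 by ring, e] at h1
      rw [show 2 * (i + 1) = 2 * i + 2 by ring, show 2 * i + 2 + l + 1 = 2 * i + l + 3 by ring]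
      have hi : (2 * i : ℂ) + l + 4 ≠ 0 := by exact_mod_cast (by omega : 2 * i + l + 4 ≠ 0)
      push_cast at h1 hj1 hj2 hj3 ⊢
      rw [eq_sub_iff_add_eq.2 h1]
      have hi3 : (2 * i : ℂ) + 3 ≠ 0 := by exact_mod_cast (by omega : 2 * i + 3 ≠ 0)
      have hi6 : (2 * i : ℂ) + l + 6 ≠ 0 := by exact_mod_cast (by omega : 2 * i + l + 6 ≠ 0)
      rw [show (2 * ((i : ℂ) + 1)) + l + 4 = 2 * i + l + 6 by ring,
        show (2 * ((i : ℂ) + 1)) + l + 2 = 2 * i + l + 4 by ring,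
        show (2 * ((i : ℂ) + 1)) + 1 = 2 * i + 3 by ring]
      field_simp
      ring
  set ρ : ℂ → ℂ := fun z => (‖z‖ : ℂ) ^ 4 with hρ
  have hρ' : ∀ z : ℂ, (‖z‖ : ℂ) ^ 4 = (z * conj z) ^ 2 := by
    intro z; rw [Complex.mul_conj', ← pow_mul]
  -- Almost everywhere `w = f z̄^(l-1)`, a form that also covers `l = 0`.
  set w : ℂ → ℂ := fun z => conj z ^ l * (f z * (conj z)⁻¹) with hw
  have hwi : Integrable w diskMeasure := by
    obtain ⟨B, hB0, hB⟩ := hf.exists_norm_le_diskMeasure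
    have h1 : Integrable (fun z => f z * (conj z)⁻¹) diskMeasure := by
      refine Integrable.mono' (integrable_inv_norm_diskMeasure.const_mul B)
        (hf.1.mul (Measurable.aestronglyMeasurable ?_)) ?_
      · exact (Complex.continuous_conj.measurable).inv
      · filter_upwards [hB] with z hz
        rw [norm_mul, norm_inv, RCLike.norm_conj]
        gcongr
    refine h1.bounded_mul_diskMeasure (B := 1)
      (Continuous.aestronglyMeasurable (by fun_prop)) fun z hz => ?_
    rw [norm_pow, RCLike.norm_conj]
    exact pow_le_one₀ (norm_nonneg z) hz.le
  have hρB : ∀ j : ℕ, ∀ z : ℂ, ‖z‖ < 1 → ‖ρ z ^ j‖ ≤ 1 := by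
    intro j z hz
    rw [hρ, ← pow_mul, norm_pow, Complex.norm_real, norm_norm]
    exact pow_le_one₀ (norm_nonneg z) hz.le
  have hρc : ∀ j : ℕ, AEStronglyMeasurable (fun z => ρ z ^ j) diskMeasure := fun j =>
    Continuous.aestronglyMeasurable (by rw [hρ]; fun_prop)
  have hρi : ∀ j : ℕ, ∀ {u : ℂ → ℂ}, Integrable u diskMeasure →
      Integrable (fun z => ρ z ^ j * u z) diskMeasure := fun j u hu =>
    hu.bounded_mul_diskMeasure (hρc j) (hρB j)
  have hρw : Integrable (fun z => ρ z * w z) diskMeasure := by simpa using hρi 1 hwi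
  have m1 : ∀ j : ℕ, ∫ z, ρ z ^ j * (ρ z * w z) ∂diskMeasure
      = moment f (2 * j + 2) (2 * j + l + 1) := by
    intro j
    refine integral_congr_ae ?_
    filter_upwards [ae_diskMeasure_ne_zero] with z hz
    have hz' : conj z ≠ 0 := by simpa using hz
    simp only [hρ, hρ', hw]
    field_simp
    ring
  -- The factor `2j + l` stays: at `j = l = 0` the truncated exponent is wrong, but both sides
  -- vanish.
  have m2 : ∀ j : ℕ, (2 * j + l) * ∫ z, ρ z ^ j * w z ∂diskMeasure
      = (2 * j + l) * moment f (2 * j) (2 * j + l - 1) := by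
    intro j
    rcases Nat.eq_zero_or_pos (2 * j + l) with h0 | h0
    · have : (2 * j : ℂ) + l = 0 := by exact_mod_cast h0
      rw [this, zero_mul, zero_mul]
    · congr 1
      refine integral_congr_ae ?_
      filter_upwards [ae_diskMeasure_ne_zero] with z hz
      have hz' : conj z ≠ 0 := by simpa using hz
      simp only [hρ, hρ', hw]
      have : conj z ^ (2 * j + l) = conj z ^ (2 * j + l - 1) * conj z := by
        rw [← pow_succ]; congr 1; omega
      rw [← mul_assoc, ← mul_assoc, ← div_eq_mul_inv, div_eq_iff hz']
      calc _ = f z * (z ^ (2 * j) * conj z ^ (2 * j + l)) := by ring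
        _ = _ := by rw [this]; ring
  have m3 : ∀ j : ℕ, ∫ z, ρ z ^ j ∂diskMeasure = (2 * j + 1 : ℂ)⁻¹ := by
    intro j
    have := integral_norm_pow_diskMeasure (2 * j)
    push_cast at this
    rw [← this]
    congr 1; ext z
    simp only [hρ]
    ring
  have m4 : ∀ j : ℕ, ∫ z, ρ z ^ j * (‖z‖ : ℂ) ^ (2 * (l + 3)) ∂diskMeasure
      = (2 * j + l + 4 : ℂ)⁻¹ := by
    intro j
    have := integral_norm_pow_diskMeasure (2 * j + l + 3)
    push_cast at this
    rw [show (2 * j + l + 4 : ℂ) = 2 * j + l + 3 + 1 by ring, ← this]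
    congr 1; ext z
    simp only [hρ]
    ring
  -- The left side of `hrel` split by its dependence on `j`: `w₁` carries the constant coefficients,
  -- `w₂` the factor `j`.
  set w₁ : ℂ → ℂ := fun z => (l + 2) * (ρ z * w z) - l * w z - 2 * C * 1
    + 2 * C * (‖z‖ : ℂ) ^ (2 * (l + 3)) with hw₁
  set w₂ : ℂ → ℂ := fun z => 2 * (ρ z * w z) - 2 * w z with hw₂
  have hI : ∀ j : ℕ, ∫ z, ρ z ^ j * w₁ z ∂diskMeasure + j * ∫ z, ρ z ^ j * w₂ z ∂diskMeasure
      = if j = 0 then -C else 0 := by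
    intro j
    have i1 := hρi j hρw
    have i2 := hρi j hwi
    have i3 : Integrable (fun z => ρ z ^ j * 1) diskMeasure := hρi j (integrable_const 1)
    have i4 := hρi j (integrable_norm_pow_diskMeasure (2 * (l + 3)))
    have e1 : ∀ z, ρ z ^ j * w₁ z = (l + 2) * (ρ z ^ j * (ρ z * w z)) - l * (ρ z ^ j * w z)
        - 2 * C * (ρ z ^ j * 1) + 2 * C * (ρ z ^ j * (‖z‖ : ℂ) ^ (2 * (l + 3))) := by
      intro z; simp only [hw₁]; ring
    have e2 : ∀ z, ρ z ^ j * w₂ z = 2 * (ρ z ^ j * (ρ z * w z)) - 2 * (ρ z ^ j * w z) := by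
      intro z; simp only [hw₂]; ring
    simp only [e1, e2]
    rw [integral_sub_sub_add (i1.const_mul _) (i2.const_mul _) (i3.const_mul _) (i4.const_mul _),
      integral_sub (i1.const_mul _) (i2.const_mul _)]
    simp only [integral_const_mul, mul_one]
    rw [← hrel j, m3, m4, m1]
    linear_combination -m2 j
  have hw₁i : Integrable w₁ diskMeasure :=
    (((hρw.const_mul _).sub (hwi.const_mul _)).sub ((integrable_const 1).const_mul _)).add
      ((integrable_norm_pow_diskMeasure _).const_mul _)
  have hw₂i : Integrable w₂ diskMeasure := (hρw.const_mul _).sub (hwi.const_mul _)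
  have h0 := integral_eq_zero_of_moments_eq_zero hw₁i hw₂i fun j hj => by
    have := hI j
    rwa [if_neg (by omega)] at this
  have := hI 0
  simp only [pow_zero, one_mul, Nat.cast_zero, zero_mul, add_zero, if_true] at this
  rw [h0] at this
  have hC0 : C = 0 := by simpa using this.symm
  exact (mul_eq_zero.1 (hC.symm.trans hC0)).resolve_left hl

/-- Diagonal `1` is that of the symbol `C z`. It forces rescaled entries `H` on diagonal `-3` whose
consecutive differences stay away from `0` along even indices unless `C = 0`, while boundedness of
`f` makes them tend to `0`. -/
theorem DiagonalVanishes.one {f : ℂ → ℂ} (hf : MemLp f ∞ diskMeasure)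
    (hM : CommutationRelations (moment f)) (h : DiagonalVanishes (moment f) 5) :
    DiagonalVanishes (moment f) 1 := by
  have hfi := hf.integrable_diskMeasure
  have h5 : DiagonalVanishes (moment f) (((1 : ℕ) : ℤ) + 4) := by simpa using h
  suffices hC : moment f 0 1 = 0 by
    simpa using h5.of_first_eq_zero hfi hM hC
  set C : ℂ := 2 * moment f 0 1 with hC
  have he : ∀ j : ℕ, moment f (2 * j) (2 * j + 1) = C / (2 * j + 2) := by
    intro j
    have := hM.diagonal_even h5 j
    have hj : (2 * j : ℂ) + 2 ≠ 0 := by exact_mod_cast (by omega : 2 * j + 2 ≠ 0)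
    rw [eq_div_iff hj, hC]
    push_cast at this
    linear_combination this
  -- `C z` has the same even entries on this diagonal, so the approximation lemma applied to `f - C
  -- z` yields the odd entry `(1, 2)`.
  have hz : Integrable (fun z => C * (1 * (z ^ 1 * conj z ^ 0))) diskMeasure :=
    (integrable_mul_monomial (integrable_const 1) 1 0).const_mul C
  have hsub : ∀ a b : ℕ, moment (fun z => f z - C * (1 * (z ^ 1 * conj z ^ 0))) a b
      = moment f a b - C * if 1 + a = b then ((1 + a : ℂ) + 1)⁻¹ else 0 := by
    intro a b
    rw [moment_sub hfi hz, moment_const_mul, moment_mul_monomial (fun _ => 1), moment_one]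
    push_cast
    simp only [zero_add]
  have h12 : moment f 1 2 = C / 3 := by
    have := moment_add_one_eq_zero (hfi.sub hz) (a := 0) (b := 1) fun j => by
      have e := hsub (0 + 2 * j) (1 + 2 * j)
      rw [if_pos (by ring), zero_add, add_comm 1, he] at e
      rw [zero_add, add_comm 1]
      refine e.trans ?_
      push_cast
      rw [show (1 : ℂ) + 2 * j + 1 = 2 * j + 2 by ring, div_eq_mul_inv, sub_self]
    have e := (hsub (0 + 1) (1 + 1)).symm.trans this
    norm_num at e
    rw [sub_eq_zero.1 e]
    ring
  have hdiag : ∀ n : ℕ, moment f n (n + 1) = C / (n + 2) := by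
    intro n
    obtain ⟨j, rfl | rfl⟩ := n.even_or_odd'
    · simpa using he j
    · have := hM.diagonal_odd h5 j
      rw [show (1 : ℕ) + 1 = 2 by rfl, h12] at this
      have hj : (2 * j : ℂ) + 3 ≠ 0 := by exact_mod_cast (by omega : 2 * j + 3 ≠ 0)
      push_cast at this ⊢
      rw [show (2 * j + 1 + 2 : ℂ) = 2 * j + 3 by ring, eq_div_iff hj]
      linear_combination this
  -- The factor `m + 1` cancels the denominator in `c_m`, turning the relation into the additive
  -- recurrence `H2`.
  set H : ℕ → ℂ := fun m => (m + 1) * moment f (m + 3) m with hH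
  have hrel : ∀ m : ℕ, (m + 1) * moment f (m + 3) m =
      2 * C / ((m + 2) * (m + 3)) + (m + 1) * (conjSqCoeff m * moment f (m + 1) (m - 2)) := by
    intro m
    have h1 := hM (m + 1) m
    rw [show m + 1 + 2 = m + 3 by ring, conjSqCoeff_add_one, hdiag (m + 1)] at h1
    have m2 : (m : ℂ) + 2 ≠ 0 := by exact_mod_cast (by omega : m + 2 ≠ 0)
    have m3 : (m : ℂ) + 3 ≠ 0 := by exact_mod_cast (by omega : m + 3 ≠ 0)
    have m1 : (m : ℂ) + 1 ≠ 0 := by exact_mod_cast (by omega : m + 1 ≠ 0)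
    rcases m with - | m
    · simp at h1 ⊢
      rw [h1]
      norm_num
      ring
    · rw [show m + 1 + 1 - 2 = m by omega, hdiag m] at h1
      rw [eq_sub_iff_add_eq.2 h1]
      push_cast at h1 m1 m2 m3 ⊢
      have m0 : (m : ℂ) + 1 ≠ 0 := by exact_mod_cast (by omega : m + 1 ≠ 0)
      have m4 : (m : ℂ) + 4 ≠ 0 := by exact_mod_cast (by omega : m + 4 ≠ 0)
      have m5 : (m : ℂ) + 3 ≠ 0 := by exact_mod_cast (by omega : m + 3 ≠ 0)
      have m6 : (m : ℂ) + 2 ≠ 0 := by exact_mod_cast (by omega : m + 2 ≠ 0)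
      rw [show (m : ℂ) + 1 + 2 = m + 3 by ring, show (m : ℂ) + 1 + 3 = m + 4 by ring,
        show (m : ℂ) + 1 + 1 + 2 = m + 4 by ring, show (m : ℂ) + 1 + 1 = m + 2 by ring]
      field_simp
      ring
  have H0 : H 0 = C / 3 := by
    have := hrel 0
    rw [conjSqCoeff_zero] at this
    simp only [hH]
    rw [this]
    push_cast
    ring
  have H1 : H 1 = C / 6 := by
    have := hrel 1
    rw [conjSqCoeff_one] at this
    simp only [hH]
    rw [this]
    push_cast
    ring
  have H2 : ∀ m, H (m + 2) = H m + 2 * C / ((m + 4) * (m + 5)) := by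
    intro m
    have := hrel (m + 2)
    rw [conjSqCoeff_add_two, Nat.add_sub_cancel] at this
    simp only [hH]
    rw [this]
    have m3 : (m : ℂ) + 3 ≠ 0 := by exact_mod_cast (by omega : m + 3 ≠ 0)
    push_cast
    rw [show (m : ℂ) + 2 + 1 = m + 3 by ring, show (m : ℂ) + 2 + 2 = m + 4 by ring,
      show (m : ℂ) + 2 + 3 = m + 5 by ring]
    field_simp
    ring
  -- The initial gap is `C/3 - C/6 = C/6`. Each step multiplies `C` by a larger real number, as `2 /
  -- ((m+4)(m+5))` decreases in `m`.
  have hx : ∀ p : ℕ, ∃ x : ℝ, 1 / 6 ≤ x ∧ H (2 * p) - H (2 * p + 1) = C * x := by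
    intro p
    induction p with
    | zero =>
      refine ⟨1 / 6, le_rfl, ?_⟩
      simp only [mul_zero, zero_add, H0, H1]
      push_cast
      ring
    | succ p ih =>
      obtain ⟨x, hx, hx'⟩ := ih
      refine ⟨x + (2 / ((2 * p + 4) * (2 * p + 5)) - 2 / ((2 * p + 5) * (2 * p + 6))), ?_, ?_⟩
      · have : (2 : ℝ) / ((2 * p + 5) * (2 * p + 6)) ≤ 2 / ((2 * p + 4) * (2 * p + 5)) := by
          apply div_le_div_of_nonneg_left <;> first | positivity | nlinarith
        linarith
      · rw [show 2 * (p + 1) = 2 * p + 2 by ring, show 2 * p + 2 + 1 = 2 * p + 1 + 2 by ring, H2, H2]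
        push_cast
        rw [show (2 * p + 1 + 4 : ℂ) = 2 * p + 5 by ring, show (2 * p + 1 + 5 : ℂ) = 2 * p + 6 by ring]
        linear_combination hx'
  obtain ⟨B, hB0, hB⟩ := hf.exists_norm_le_diskMeasure
  -- The integrand is `f z³` times `(m+1)(|z|^(2m) - |z|^(2m+2)) - |z|^(2m+2)`. Both terms have
  -- integral `1/(m+2)`, whence the constant `2B/(m+2)`.
  have hdiff : ∀ m : ℕ, ‖H m - H (m + 1)‖ ≤ 2 * B / (m + 2) := by
    intro m
    have i1 : ∀ a : ℕ, Integrable (fun z : ℂ => ‖z‖ ^ a) diskMeasure := fun a => by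
      simpa using (integrable_norm_pow_diskMeasure a).norm
    have r1 : ∀ a : ℕ, ∫ z : ℂ, ‖z‖ ^ (2 * a) ∂diskMeasure = (a + 1 : ℝ)⁻¹ := by
      intro a
      have := integral_norm_pow_diskMeasure a
      simp_rw [← Complex.ofReal_pow] at this
      rw [integral_complex_ofReal] at this
      apply Complex.ofReal_injective
      rw [this]
      push_cast
      rfl
    have e : H m - H (m + 1) = ∫ z, ((m + 1) * (f z * (z ^ (m + 3) * conj z ^ m))
        - (m + 2) * (f z * (z ^ (m + 4) * conj z ^ (m + 1)))) ∂diskMeasure := by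
      rw [integral_sub ((integrable_mul_monomial hfi _ _).const_mul _)
        ((integrable_mul_monomial hfi _ _).const_mul _), integral_const_mul, integral_const_mul]
      simp only [hH, moment]
      push_cast
      ring_nf
    have i2 : Integrable (fun z : ℂ => (m + 1) * (‖z‖ ^ (2 * m) - ‖z‖ ^ (2 * (m + 1)))) diskMeasure :=
      ((i1 _).sub (i1 _)).const_mul _
    have e2 : 2 * B / (m + 2) = ∫ z : ℂ, B * ((m + 1) * (‖z‖ ^ (2 * m) - ‖z‖ ^ (2 * (m + 1)))
        + ‖z‖ ^ (2 * (m + 1))) ∂diskMeasure := by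
      rw [integral_const_mul, integral_add i2 (i1 _),
        integral_const_mul, integral_sub (i1 _) (i1 _), r1, r1]
      push_cast
      field_simp
      ring
    rw [e, e2]
    refine norm_integral_le_of_norm_le ((i2.add (i1 _)).const_mul _) ?_
    filter_upwards [hB, ae_diskMeasure_norm_lt_one] with z hz hz1
    have e3 : (m + 1) * (f z * (z ^ (m + 3) * conj z ^ m))
        - (m + 2) * (f z * (z ^ (m + 4) * conj z ^ (m + 1)))
        = f z * (z ^ 3 * (((m + 1) * (‖z‖ ^ (2 * m) - ‖z‖ ^ (2 * (m + 1)))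
          - ‖z‖ ^ (2 * (m + 1)) : ℝ) : ℂ)) := by
      push_cast
      simp only [pow_mul, ← Complex.mul_conj']
      ring
    rw [e3, norm_mul, norm_mul, Complex.norm_real, norm_pow]
    have hs : 0 ≤ ‖z‖ ^ (2 * m) - ‖z‖ ^ (2 * (m + 1)) :=
      sub_nonneg.2 (pow_le_pow_of_le_one (norm_nonneg z) hz1.le (by omega))
    have ht : 0 ≤ ‖z‖ ^ (2 * (m + 1)) := by positivity
    have hs' : 0 ≤ ((m : ℝ) + 1) * (‖z‖ ^ (2 * m) - ‖z‖ ^ (2 * (m + 1))) := by positivity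
    have hz3 : ‖z‖ ^ 3 ≤ 1 := pow_le_one₀ (norm_nonneg z) hz1.le
    refine mul_le_mul hz ?_ (by positivity) hB0
    refine (mul_le_of_le_one_left (norm_nonneg _) hz3).trans ?_
    rw [Real.norm_eq_abs, abs_le]
    constructor <;> linarith
  have hb : ∀ p : ℕ, ‖C‖ / 6 ≤ 2 * B / (p + 2) := by
    intro p
    obtain ⟨x, hx, hx'⟩ := hx p
    have h1 := hdiff (2 * p)
    rw [hx', norm_mul, Complex.norm_real, Real.norm_of_nonneg (by linarith)] at h1
    have h2 : 2 * B / (((2 * p : ℕ) : ℝ) + 2) ≤ 2 * B / (p + 2) := by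
      apply div_le_div_of_nonneg_left (by positivity) (by positivity)
      push_cast
      have : (0 : ℝ) ≤ p := Nat.cast_nonneg p
      linarith
    nlinarith [norm_nonneg C]
  have ht : Tendsto (fun p : ℕ => 2 * B / ((p : ℝ) + 2)) atTop (𝓝 0) :=
    tendsto_const_nhds.div_atTop (tendsto_atTop_add_const_right _ _ tendsto_natCast_atTop_atTop)
  have hle := ge_of_tendsto' ht hb
  have hC0 : C = 0 := norm_le_zero_iff.1 (by linarith)
  simpa [hC] using hC0

/-! ### Descent through the diagonals. -/

/-- A bounded symbol whose moments satisfy the commutation relations and vanish on all diagonals of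
large index has vanishing moments, once the moments `(0, 0)` and `(0, 2)` vanish. -/
theorem moment_eq_zero_of_commutationRelations {f : ℂ → ℂ} (hf : MemLp f ∞ diskMeasure)
    (hM : CommutationRelations (moment f)) {K : ℤ}
    (hK : ∀ k, K < k → DiagonalVanishes (moment f) k) (h0 : moment f 0 0 = 0)
    (h2 : moment f 0 2 = 0) (a b : ℕ) : moment f a b = 0 := by
  have hfi := hf.integrable_diskMeasure
  have step : ∀ k : ℤ, DiagonalVanishes (moment f) (k + 4) → DiagonalVanishes (moment f) k := by
    intro k hk
    rcases le_or_gt k (-2) with h | h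
    · exact hk.of_le_neg_two hM h
    rcases eq_or_ne k (-1) with rfl | h'
    · exact hk.neg_one hfi hM
    obtain ⟨n, rfl⟩ : ∃ n : ℕ, k = n := ⟨k.toNat, by omega⟩
    rcases Nat.lt_or_ge n 3 with hn | hn
    · interval_cases n
      · exact hk.of_first_eq_zero hfi hM h0
      · exact hk.one hf hM
      · exact hk.of_first_eq_zero hfi hM h2
    · exact hk.of_three_le hf hM hn
  have all : ∀ (n : ℕ) (k : ℤ), K - 4 * n < k → DiagonalVanishes (moment f) k := by
    intro n
    induction n with
    | zero => intro k hk; exact hK k (by simpa using hk)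
    | succ n ih => intro k hk; exact step k (ih _ (by push_cast at hk; linarith))
  exact all (K - (b - a) + 1).toNat ((b : ℤ) - a) (by omega) a b rfl

/-! ### Vanishing of high diagonals from the truncated polar decomposition. -/

theorem lintegral_comp_norm_complex {F : ℝ → ℝ≥0∞} (hF : Measurable F) :
    ∫⁻ z : ℂ, F ‖z‖ = ENNReal.ofReal (2 * Real.pi) *
      ∫⁻ r in Set.Ioi (0 : ℝ), ENNReal.ofReal r * F r := by
  rw [← Complex.lintegral_comp_polarCoord_symm,
    show polarCoord.target = Set.Ioi (0 : ℝ) ×ˢ Set.Ioo (-Real.pi) Real.pi from rfl,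
    Measure.volume_eq_prod, ← Measure.prod_restrict, lintegral_prod _ (by
      have : Measurable fun p : ℝ × ℝ => Complex.polarCoord.symm p := by
        simp only [Complex.polarCoord_symm_apply]; fun_prop
      exact Measurable.aemeasurable (by fun_prop)), ← lintegral_const_mul _ (by fun_prop)]
  refine setLIntegral_congr_fun measurableSet_Ioi fun r hr => ?_
  simp only [Complex.norm_polarCoord_symm, smul_eq_mul, abs_of_pos (Set.mem_Ioi.1 hr)]
  rw [setLIntegral_const, Real.volume_Ioo, mul_comm]
  congr 2
  ring

/-- The factor is `2π / π`. This transfers radial square integrability to the disk. -/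
theorem map_norm_diskMeasure : diskMeasure.map (fun z : ℂ => ‖z‖) = (2 : ℝ≥0∞) • radialMeasure := by
  ext s hs
  have h0 : ENNReal.ofReal Real.pi ≠ 0 := by simpa using Real.pi_pos
  have hs' : MeasurableSet (s ∩ Set.Iio 1) := hs.inter measurableSet_Iio
  rw [Measure.map_apply measurable_norm hs, diskMeasure, Measure.smul_apply, Measure.smul_apply,
    Measure.restrict_apply (measurable_norm hs), radialMeasure, withDensity_apply _ hs,
    smul_eq_mul, smul_eq_mul]
  have e1 : (fun z : ℂ => ‖z‖) ⁻¹' s ∩ ball 0 1 = (fun z : ℂ => ‖z‖) ⁻¹' (s ∩ Set.Iio 1) := by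
    ext z; simp
  rw [e1, ← lintegral_indicator_one (measurable_norm hs')]
  have e2 : ∀ z : ℂ, ((fun z : ℂ => ‖z‖) ⁻¹' (s ∩ Set.Iio 1)).indicator (1 : ℂ → ℝ≥0∞) z
      = (s ∩ Set.Iio 1).indicator (1 : ℝ → ℝ≥0∞) ‖z‖ := fun z => rfl
  simp only [e2]
  rw [lintegral_comp_norm_complex (measurable_one.indicator hs'), mul_comm 2 Real.pi,
    ENNReal.ofReal_mul Real.pi_pos.le, ← mul_assoc, ← mul_assoc,
    ENNReal.inv_mul_cancel h0 ENNReal.ofReal_ne_top, one_mul, ENNReal.ofReal_ofNat]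
  congr 1
  have e3 : ∀ r : ℝ, ENNReal.ofReal r * (s ∩ Set.Iio 1).indicator (1 : ℝ → ℝ≥0∞) r
      = (s ∩ Set.Iio 1).indicator (fun r => ENNReal.ofReal r) r := by
    intro r
    by_cases hr : r ∈ s ∩ Set.Iio 1 <;> simp [hr]
  simp only [e3]
  rw [lintegral_indicator hs', Measure.restrict_restrict hs', Measure.restrict_restrict hs]
  refine setLIntegral_congr ?_
  have e4 : s ∩ Set.Iio 1 ∩ Set.Ioi 0 = s ∩ Set.Ioo 0 1 := by
    ext r; simp only [Set.mem_inter_iff, Set.mem_Iio, Set.mem_Ioi, Set.mem_Ioo]; tauto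
  rw [e4]
  exact (ae_eq_refl s).inter Ioo_ae_eq_Icc

theorem memLp_quasihomogeneous {k : ℤ} {φ : ℝ → ℂ} (hφ : MemLp φ 2 radialMeasure) :
    MemLp (quasihomogeneous k φ) 2 diskMeasure := by
  have h1 : MemLp (fun z : ℂ => φ ‖z‖) 2 diskMeasure := by
    refine MemLp.comp_of_map (f := fun z : ℂ => ‖z‖) ?_ measurable_norm.aemeasurable
    rw [map_norm_diskMeasure]
    exact hφ.smul_measure (by simp)
  have hm : Measurable fun z : ℂ => Complex.exp (k * z.arg * Complex.I) := by fun_prop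
  refine h1.of_le (hm.aestronglyMeasurable.mul h1.1) (Eventually.of_forall fun z => ?_)
  rw [quasihomogeneous, norm_mul, show (k * z.arg * Complex.I : ℂ) = ((k * z.arg : ℝ) : ℂ) * Complex.I
    by push_cast; ring, Complex.norm_exp_ofReal_mul_I, one_mul]

theorem quasihomogeneous_rotation (k : ℤ) (φ : ℝ → ℂ) (θ : ℝ) {z : ℂ} (hz : z ≠ 0) :
    quasihomogeneous k φ (Complex.exp (θ * Complex.I) * z)
      = Complex.exp (k * θ * Complex.I) * quasihomogeneous k φ z := by
  have hpol : ∀ {w : ℂ}, w ≠ 0 → Complex.exp (k * w.arg * Complex.I) = (w / ‖w‖) ^ k := by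
    intro w hw
    have hn : (‖w‖ : ℂ) ≠ 0 := by simpa using hw
    rw [mul_assoc, Complex.exp_int_mul]
    congr 1
    rw [eq_div_iff hn, mul_comm, Complex.norm_mul_exp_arg_mul_I]
  have hne : Complex.exp (θ * Complex.I) * z ≠ 0 := mul_ne_zero (Complex.exp_ne_zero _) hz
  have hnorm : ‖Complex.exp (θ * Complex.I) * z‖ = ‖z‖ := by
    rw [norm_mul, Complex.norm_exp_ofReal_mul_I, one_mul]
  rw [quasihomogeneous, quasihomogeneous, hpol hne, hpol hz, hnorm, mul_div_assoc, mul_zpow,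
    ← Complex.exp_int_mul]
  ring_nf

/-- The integrand has angular order `k + a - b ≠ 0`. -/
theorem moment_quasihomogeneous {k : ℤ} (φ : ℝ → ℂ) {a b : ℕ} (h : (b : ℤ) - a ≠ k) :
    moment (quasihomogeneous k φ) a b = 0 := by
  rw [moment, integral_diskMeasure, setIntegral_ball_eq_zero_of_homogeneous (k := k + a - b)
    (by omega), mul_zero]
  intro θ z hz
  rw [quasihomogeneous_rotation k φ θ hz, map_mul, ← Complex.exp_conj, mul_pow, mul_pow,
    ← Complex.exp_nat_mul, ← Complex.exp_nat_mul]
  have : Complex.exp ((k + a - b : ℤ) * θ * Complex.I) =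
      Complex.exp (k * θ * Complex.I) * (Complex.exp (a * (θ * Complex.I)) *
        Complex.exp (b * conj (θ * Complex.I))) := by
    rw [← Complex.exp_add, ← Complex.exp_add]
    congr 1
    simp
    ring
  rw [this]; ring

/-- A moment is bounded by the `L²` norm and vanishes on every partial sum, whose orders are at most
`N < k`. -/
theorem HasTruncatedPolarDecomposition.diagonalVanishes {f : ℂ → ℂ} (hf : MemLp f ∞ diskMeasure)
    {N : ℤ} {φ : ℤ → ℝ → ℂ} (h : HasTruncatedPolarDecomposition f N φ) {k : ℤ} (hk : N < k) :
    DiagonalVanishes (moment f) k := by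
  intro a b hab
  have hfi := hf.integrable_diskMeasure
  have hq : ∀ j : Set.Iic N, Integrable (quasihomogeneous j (φ j)) diskMeasure := fun j =>
    (memLp_quasihomogeneous (h.memLp j j.2)).integrable (by norm_num)
  have hle : ∀ s : Finset (Set.Iic N), ‖moment f a b‖ₑ ≤
      eLpNorm (fun z => f z - ∑ k ∈ s, quasihomogeneous k (φ k) z) 2 diskMeasure := by
    intro s
    have hS : Integrable (fun z => ∑ k ∈ s, quasihomogeneous k (φ k) z) diskMeasure :=
      integrable_finsetSum s fun j _ => hq j
    have h0 : moment (fun z => ∑ k ∈ s, quasihomogeneous k (φ k) z) a b = 0 := by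
      simp only [moment, Finset.sum_mul]
      rw [integral_finsetSum s fun j _ => integrable_mul_monomial (hq j) a b]
      refine Finset.sum_eq_zero fun j _ => moment_quasihomogeneous (φ j) ?_
      have : (j : ℤ) ≤ N := j.2
      omega
    have h1 : moment f a b = moment (fun z => f z - ∑ k ∈ s, quasihomogeneous k (φ k) z) a b := by
      rw [moment_sub hfi hS, h0, sub_zero]
    calc ‖moment f a b‖ₑ ≤ ∫⁻ z, ‖f z - ∑ k ∈ s, quasihomogeneous k (φ k) z‖ₑ ∂diskMeasure := by
          rw [h1, moment]
          refine (enorm_integral_le_lintegral_enorm _).trans (lintegral_mono_ae ?_)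
          filter_upwards [ae_diskMeasure_norm_lt_one] with z hz
          rw [enorm_mul]
          refine mul_le_of_le_one_right' ?_
          rw [← ofReal_norm]
          exact ENNReal.ofReal_le_one.2 (norm_monomial_le_one hz a b)
      _ ≤ _ := by
          rw [← eLpNorm_one_eq_lintegral_enorm]
          exact eLpNorm_le_eLpNorm_of_exponent_le (by norm_num) (hfi.sub hS).1
  have := ge_of_tendsto' h.tendsto hle
  simpa using this

/-! ### Moments determine an integrable function. -/

/-- The radial retraction of the plane onto the closed unit disk. -/
noncomputable def closedDiskRetraction : C(ℂ, closedBall (0 : ℂ) 1) where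
  toFun z := ⟨z / (max 1 ‖z‖ : ℝ), by
    have h : 0 < max 1 ‖z‖ := lt_of_lt_of_le one_pos (le_max_left _ _)
    rw [mem_closedBall_zero_iff, norm_div, Complex.norm_real, Real.norm_of_nonneg h.le,
      div_le_one h]
    exact le_max_right _ _⟩
  continuous_toFun := by
    refine Continuous.subtype_mk (continuous_id.div (by fun_prop) fun z => ?_) _
    have h : 0 < max 1 ‖z‖ := lt_of_lt_of_le one_pos (le_max_left _ _)
    exact_mod_cast h.ne'

theorem coe_closedDiskRetraction {z : ℂ} (hz : ‖z‖ ≤ 1) : (closedDiskRetraction z : ℂ) = z := by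
  simp [closedDiskRetraction, max_eq_left hz]

/-- Stone-Weierstrass induction over the algebra generated by `z` and `z̄`. Quantifying over `u`
inside the induction lets a product `F G` be treated by applying the claim for `G` to `u F`. -/
theorem moment_mul_continuousMap_eq_zero (F : C(closedBall (0 : ℂ) 1, ℂ)) :
    ∀ u : ℂ → ℂ, Integrable u diskMeasure → (∀ a b, moment u a b = 0) →
      ∀ a b, moment (fun z => u z * F (closedDiskRetraction z)) a b = 0 := by
  have hint : ∀ (F : C(closedBall (0 : ℂ) 1, ℂ)) {u : ℂ → ℂ}, Integrable u diskMeasure →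
      Integrable (fun z => u z * F (closedDiskRetraction z)) diskMeasure := by
    intro F u hu
    simp_rw [mul_comm (u _)]
    exact hu.bounded_mul_diskMeasure (F.comp closedDiskRetraction).continuous.aestronglyMeasurable
      fun z _ => F.norm_coe_le_norm _
  induction F using ContinuousMap.induction_on_of_compact with
  | const r =>
    intro u _ h a b
    simp only [ContinuousMap.const_apply]
    simp_rw [mul_comm (u _)]
    rw [moment_const_mul, h, mul_zero]
  | id =>
    intro u _ h a b
    refine Eq.trans ?_ ((moment_mul_monomial u 1 0 a b).trans (h (1 + a) (0 + b)))
    refine integral_congr_ae ?_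
    filter_upwards [ae_diskMeasure_norm_lt_one] with z hz
    simp [coe_closedDiskRetraction hz.le]
  | star_id =>
    intro u _ h a b
    refine Eq.trans ?_ ((moment_mul_monomial u 0 1 a b).trans (h (0 + a) (1 + b)))
    refine integral_congr_ae ?_
    filter_upwards [ae_diskMeasure_norm_lt_one] with z hz
    simp [coe_closedDiskRetraction hz.le]
  | add F G hF hG =>
    intro u hu h a b
    have e1 := hF u hu h a b
    have e2 := hG u hu h a b
    simp only [moment, ContinuousMap.add_apply, mul_add, add_mul] at e1 e2 ⊢
    rw [integral_add (integrable_mul_monomial (hint F hu) a b)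
      (integrable_mul_monomial (hint G hu) a b), e1, e2, add_zero]
  | mul F G hF hG =>
    intro u hu h a b
    have := hG _ (hint F hu) (hF u hu h) a b
    simpa only [ContinuousMap.mul_apply, mul_assoc] using this
  | frequently F hF =>
    intro u hu h a b
    have hb : ∀ ε > 0, ‖moment (fun z => u z * F (closedDiskRetraction z)) a b‖
        ≤ ε * ∫ z, ‖u z‖ ∂diskMeasure := by
      intro ε hε
      obtain ⟨G, hG, hGF⟩ := (hF.and_eventually (ball_mem_nhds F hε)).exists
      have e := hG u hu h a b
      have e' := moment_sub (hint F hu) (hint G hu) a b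
      rw [e, sub_zero] at e'
      rw [← e', moment, ← integral_const_mul]
      refine norm_integral_le_of_norm_le (hu.norm.const_mul ε) ?_
      filter_upwards [ae_diskMeasure_norm_lt_one] with z hz
      rw [← mul_sub, norm_mul, norm_mul]
      have h1 : ‖F (closedDiskRetraction z) - G (closedDiskRetraction z)‖ ≤ ε := by
        rw [← dist_eq_norm]
        exact ((F.dist_apply_le_dist _).trans_lt (by rwa [dist_comm])).le
      calc _ ≤ ‖u z‖ * ε * 1 := by
            gcongr
            exact norm_monomial_le_one hz a b
        _ = _ := by ring
    have ht : Tendsto (fun ε : ℝ => ε * ∫ z, ‖u z‖ ∂diskMeasure) (𝓝[>] 0) (𝓝 0) := by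
      have := (continuous_mul_const (∫ z, ‖u z‖ ∂diskMeasure)).tendsto 0
      rw [zero_mul] at this
      exact this.mono_left nhdsWithin_le_nhds
    exact norm_le_zero_iff.1 (ge_of_tendsto ht (eventually_nhdsWithin_of_forall hb))

/-- An integrable function on the disk all of whose moments vanish is zero almost everywhere. -/
theorem ae_eq_zero_of_moment_eq_zero {u : ℂ → ℂ} (hu : Integrable u diskMeasure)
    (h : ∀ a b, moment u a b = 0) : u =ᵐ[diskMeasure] 0 := by
  refine ae_eq_zero_of_integral_contDiff_smul_eq_zero hu.locallyIntegrable fun g hg _ => ?_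
  let F : C(closedBall (0 : ℂ) 1, ℂ) := ⟨fun z => (g z : ℂ), by
    exact Complex.continuous_ofReal.comp (hg.continuous.comp continuous_subtype_val)⟩
  rw [← moment_mul_continuousMap_eq_zero F u hu h 0 0, moment]
  refine integral_congr_ae ?_
  filter_upwards [ae_diskMeasure_norm_lt_one] with z hz
  simp only [F, ContinuousMap.coe_mk, coe_closedDiskRetraction hz.le, Complex.real_smul]
  ring

/-! ### The action of `T_{z²+z̄²}` on monomials. -/

/-- Functions holomorphic on the disk pair with `z² z̄ⁿ` and `z̄^{n-2}` proportionally, on every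
smaller disk. -/
theorem setIntegral_ball_holomorphic_mul {v : ℂ → ℂ} (hv : DifferentiableOn ℂ v (ball (0 : ℂ) 1))
    {R : ℝ} (hR0 : 0 ≤ R) (hR : R < 1) (n : ℕ) :
    ∫ z in ball (0 : ℂ) R, v z * (z ^ 2 * conj z ^ n - R ^ 4 * (conjSqCoeff n * conj z ^ (n - 2))) = 0 := by
  -- A radius `S > R` gives absolute convergence of the Taylor series on the ball of radius `R`,
  -- hence termwise integration.
  obtain ⟨S, hRS, hS⟩ := exists_between hR
  have hS0 : 0 < S := hR0.trans_lt hRS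
  lift S to NNReal using hS0.le
  have hp := (hv.mono (closedBall_subset_ball hS)).hasFPowerSeriesOnBall (by exact_mod_cast hS0)
  set p := cauchyPowerSeries v 0 S with hpdef
  set G : ℂ → ℂ := fun z => z ^ 2 * conj z ^ n - R ^ 4 * (conjSqCoeff n * conj z ^ (n - 2)) with hG
  have hGc : Continuous G := by rw [hG]; fun_prop
  obtain ⟨B, hB⟩ := (isCompact_closedBall (0 : ℂ) R).exists_bound_of_continuousOn hGc.continuousOn
  set F : ℕ → ℂ → ℂ := fun i z => p.coeff i * (z ^ i * G z) with hF
  have hFc : ∀ i, Continuous (F i) := fun i => by rw [hF]; fun_prop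
  have hFi : ∀ i, IntegrableOn (F i) (ball 0 R) := fun i =>
    ((hFc i).continuousOn.integrableOn_compact (isCompact_closedBall 0 R)).mono_set ball_subset_closedBall
  -- By orthogonality only `i = n - 2` can contribute; there the two radial integrals have ratio `R⁴
  -- (n-1)/(n+1)`.
  have hzero : ∀ i, ∫ z in ball (0 : ℂ) R, F i z = 0 := by
    intro i
    have e : ∀ z, F i z = p.coeff i * (z ^ (i + 2) * conj z ^ n
        - R ^ 4 * conjSqCoeff n * (z ^ i * conj z ^ (n - 2))) := by
      intro z; simp only [hF, hG]; ring
    have hi : ∀ a b : ℕ, IntegrableOn (fun z : ℂ => z ^ a * conj z ^ b) (ball 0 R) := fun a b =>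
      (Continuous.continuousOn (by fun_prop)).integrableOn_compact (isCompact_closedBall 0 R)
        |>.mono_set ball_subset_closedBall
    simp only [e]
    rw [integral_const_mul, integral_sub (hi _ _) ((hi _ _).const_mul _), integral_const_mul,
      setIntegral_ball_monomial hR0, setIntegral_ball_monomial hR0]
    rcases n with - | - | n
    · simp [conjSqCoeff_zero]
    · simp [conjSqCoeff_one]
    · rw [show n + 1 + 1 - 2 = n by omega, conjSqCoeff_add_two]
      by_cases h : i = n
      · subst h
        have h1 : (i : ℂ) + 1 ≠ 0 := by exact_mod_cast (by omega : i + 1 ≠ 0)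
        have h3 : (i : ℂ) + 3 ≠ 0 := by exact_mod_cast (by omega : i + 3 ≠ 0)
        rw [if_pos rfl, if_pos rfl]
        push_cast
        rw [show (i : ℂ) + 2 + 1 = i + 3 by ring]
        field_simp
        ring
      · rw [if_neg h, if_neg (by omega)]
        simp
  have hsumm : Summable fun i => ∫ z in ball (0 : ℂ) R, ‖F i z‖ := by
    have hs : Summable fun i => ‖p i‖ * (R.toNNReal : ℝ) ^ i :=
      p.summable_norm_mul_pow (lt_of_lt_of_le (by
        rw [ENNReal.coe_lt_coe, Real.toNNReal_lt_iff_lt_coe hR0]; exact hRS) hp.r_le)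
    rw [Real.coe_toNNReal R hR0] at hs
    refine Summable.of_nonneg_of_le (fun i => integral_nonneg fun z => norm_nonneg _)
      (fun i => ?_) (hs.mul_right (B * (volume : Measure ℂ).real (ball 0 R)))
    calc ∫ z in ball (0 : ℂ) R, ‖F i z‖ ≤ ∫ z in ball (0 : ℂ) R, ‖p i‖ * R ^ i * B := by
          refine setIntegral_mono_on (hFi i).norm (integrableOn_const measure_ball_lt_top.ne)
            measurableSet_ball fun z hz => ?_
          have hz' : ‖z‖ ≤ R := (mem_ball_zero_iff.1 hz).le
          rw [hF]
          dsimp only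
          rw [norm_mul, norm_mul, norm_pow, ← mul_assoc, ← p.norm_apply_eq_norm_coef]
          have := hB z (by simpa using hz')
          gcongr
      _ = _ := by
          rw [setIntegral_const, smul_eq_mul]
          ring
  have hsum := hasSum_integral_of_summable_integral_norm hFi hsumm
  simp only [hzero] at hsum
  have h0 := hsum.unique hasSum_zero
  refine Eq.trans ?_ h0
  refine setIntegral_congr_fun measurableSet_ball fun z hz => ?_
  have hz' : z ∈ eball (0 : ℂ) S := by
    rw [mem_eball, edist_zero_right, ← ofReal_norm, ENNReal.ofReal_lt_coe_iff]
    · exact (mem_ball_zero_iff.1 hz).trans hRS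
    · exact norm_nonneg z
  have := (hp.hasSum_sub hz').mul_right (G z)
  rw [← this.tsum_eq]
  refine tsum_congr fun i => ?_
  simp [hF, smul_eq_mul]
  ring

/-- Dominated convergence as `R → 1`; the Taylor series need not converge up to the boundary. -/
theorem integral_holomorphic_mul_eq_zero {v : ℂ → ℂ} (hv : DifferentiableOn ℂ v (ball (0 : ℂ) 1))
    (hvi : Integrable v diskMeasure) (n : ℕ) :
    ∫ z, v z * (z ^ 2 * conj z ^ n - conjSqCoeff n * conj z ^ (n - 2)) ∂diskMeasure = 0 := by
  obtain ⟨R, -, hR, hRt⟩ := exists_seq_strictMono_tendsto' (show (0 : ℝ) < 1 by norm_num)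
  have hRc : Tendsto (fun i => (R i : ℂ) ^ 4) atTop (𝓝 1) := by
    have := ((Complex.continuous_ofReal.tendsto 1).comp hRt).pow 4
    simpa using this
  set G : ℕ → ℂ → ℂ := fun i z => (ball (0 : ℂ) (R i)).indicator (fun z => v z * (z ^ 2 * conj z ^ n
    - R i ^ 4 * (conjSqCoeff n * conj z ^ (n - 2)))) z with hG
  have hGm : ∀ i, AEStronglyMeasurable (G i) diskMeasure := fun i =>
    (hvi.1.mul (Continuous.aestronglyMeasurable (by fun_prop))).indicator measurableSet_ball
  have hzero : ∀ i, ∫ z, G i z ∂diskMeasure = 0 := by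
    intro i
    rw [integral_diskMeasure, hG]
    dsimp only
    rw [setIntegral_indicator measurableSet_ball,
      Set.inter_eq_right.2 (ball_subset_ball (hR i).2.le),
      setIntegral_ball_holomorphic_mul hv (hR i).1.le (hR i).2, mul_zero]
  have hlim : Tendsto (fun i => ∫ z, G i z ∂diskMeasure) atTop
      (𝓝 (∫ z, v z * (z ^ 2 * conj z ^ n - conjSqCoeff n * conj z ^ (n - 2)) ∂diskMeasure)) := by
    refine tendsto_integral_of_dominated_convergence (fun z => ‖v z‖ * (1 + ‖conjSqCoeff n‖)) hGm
      (hvi.norm.mul_const _) (fun i => ?_) ?_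
    · filter_upwards [ae_diskMeasure_norm_lt_one] with z hz
      have hz0 := norm_nonneg z
      refine (norm_indicator_le_norm_self _ _).trans ?_
      rw [norm_mul]
      gcongr
      refine (norm_sub_le _ _).trans (add_le_add (norm_monomial_le_one hz 2 n) ?_)
      rw [norm_mul, norm_mul, norm_pow, norm_pow, RCLike.norm_conj, Complex.norm_real,
        Real.norm_of_nonneg (hR i).1.le, ← mul_assoc]
      have h1 : R i ^ 4 ≤ 1 := pow_le_one₀ (hR i).1.le (hR i).2.le
      have h2 : ‖z‖ ^ (n - 2) ≤ 1 := pow_le_one₀ hz0 hz.le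
      calc R i ^ 4 * ‖conjSqCoeff n‖ * ‖z‖ ^ (n - 2) ≤ 1 * ‖conjSqCoeff n‖ * 1 := by gcongr
        _ = _ := by ring
    · filter_upwards [ae_diskMeasure_norm_lt_one] with z hz
      have h1 : Tendsto (fun i => v z * (z ^ 2 * conj z ^ n
          - R i ^ 4 * (conjSqCoeff n * conj z ^ (n - 2)))) atTop
          (𝓝 (v z * (z ^ 2 * conj z ^ n - 1 * (conjSqCoeff n * conj z ^ (n - 2))))) :=
        ((hRc.mul_const _).const_sub _).const_mul _
      rw [one_mul] at h1
      refine h1.congr' ?_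
      filter_upwards [hRt.eventually (lt_mem_nhds hz)] with i hi
      rw [hG]
      dsimp only
      rw [Set.indicator_of_mem (mem_ball_zero_iff.2 hi)]
  simp only [hzero] at hlim
  exact tendsto_nhds_unique hlim tendsto_const_nhds

theorem memLp_pow_diskMeasure (n : ℕ) : MemLp (fun z : ℂ => z ^ n) 2 diskMeasure := by
  refine MemLp.of_bound (Continuous.aestronglyMeasurable (by fun_prop)) 1 ?_
  filter_upwards [ae_diskMeasure_norm_lt_one] with z hz
  rw [norm_pow]
  exact pow_le_one₀ (norm_nonneg z) hz.le

theorem bergmanSpace_inner_smul_right (u v : bergmanSpace) (c : ℂ) :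
    inner ℂ u (c • v) = c * inner ℂ u v :=
  inner_smul_right u v c

theorem bergmanSpace_inner_smul_left (u v : bergmanSpace) (c : ℂ) :
    inner ℂ (c • u) v = conj c * inner ℂ u v :=
  inner_smul_left u v c

theorem bergmanSpace_inner_conj_symm (u v : bergmanSpace) :
    conj (inner ℂ v u) = inner ℂ u v :=
  inner_conj_symm u v

/-- The monomial `z^n` as an element of the Bergman space. -/
noncomputable def bergmanMonomial (n : ℕ) : bergmanSpace :=
  ⟨MemLp.toLp (fun z : ℂ => z ^ n) (memLp_pow_diskMeasure n), fun z => z ^ n, by fun_prop, MemLp.coeFn_toLp (memLp_pow_diskMeasure n)⟩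

theorem bergmanMonomial_coeFn (n : ℕ) :
    (bergmanMonomial n : Lp ℂ 2 diskMeasure) =ᵐ[diskMeasure] fun z => z ^ n :=
  MemLp.coeFn_toLp (memLp_pow_diskMeasure n)

theorem inner_toeplitz {f : ℂ → ℂ} (hf : MemLp f ∞ diskMeasure) (u v : bergmanSpace) :
    inner ℂ u (toeplitz f hf v) = ∫ z, f z * (v : Lp ℂ 2 diskMeasure) z *
      conj ((u : Lp ℂ 2 diskMeasure) z) ∂diskMeasure := by
  rw [toeplitz, ContinuousLinearMap.comp_apply, ContinuousLinearMap.comp_apply, bergmanProjection,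
    Submodule.inner_orthogonalProjectionOnto_eq_of_mem_left, L2.inner_def]
  refine integral_congr_ae ?_
  filter_upwards [multiplicationOperator_coeFn (hf.toLp f) (bergmanSpace.subtypeL v), hf.coeFn_toLp]
    with z h1 h2
  rw [h1, h2, RCLike.inner_apply]
  rfl

theorem inner_toeplitz_bergmanMonomial {f : ℂ → ℂ} (hf : MemLp f ∞ diskMeasure) (n m : ℕ) :
    inner ℂ (bergmanMonomial m) (toeplitz f hf (bergmanMonomial n)) = moment f n m := by
  rw [inner_toeplitz, moment]
  refine integral_congr_ae ?_
  filter_upwards [bergmanMonomial_coeFn n, bergmanMonomial_coeFn m] with z h1 h2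
  rw [h1, h2, map_pow]
  ring

/-- Tested against a holomorphic `v`: the `z²` part is immediate, and the `z̄²` part is the
conjugate of `integral_holomorphic_mul_eq_zero`. -/
theorem toeplitz_sqAddConjSq_bergmanMonomial (n : ℕ) :
    toeplitz sqAddConjSq sqAddConjSq_memLp (bergmanMonomial n)
      = bergmanMonomial (n + 2) + conjSqCoeff n • bergmanMonomial (n - 2) := by
  refine ext_inner_left ℂ fun u => ?_
  obtain ⟨v, hv, huv⟩ := u.2
  have hvi : Integrable v diskMeasure :=
    ((Lp.memLp (u : Lp ℂ 2 diskMeasure)).integrable (by norm_num)).congr huv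
  have hcv : Integrable (fun z => conj (v z)) diskMeasure :=
    hvi.congr' (Complex.continuous_conj.comp_aestronglyMeasurable hvi.1)
      (Eventually.of_forall fun z => by simp)
  have hmul : ∀ {g : ℂ → ℂ}, Continuous g → Integrable (fun z => g z * conj (v z)) diskMeasure := by
    intro g hg
    obtain ⟨B, hB⟩ := (isCompact_closedBall (0 : ℂ) 1).exists_bound_of_continuousOn hg.continuousOn
    exact hcv.bounded_mul_diskMeasure hg.aestronglyMeasurable fun z hz => hB z (by simpa using hz.le)
  have hmono : ∀ m, inner ℂ u (bergmanMonomial m) = ∫ z, z ^ m * conj (v z) ∂diskMeasure := by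
    intro m
    rw [Submodule.coe_inner, L2.inner_def]
    refine integral_congr_ae ?_
    filter_upwards [bergmanMonomial_coeFn m, huv] with z h1 h2
    rw [h1, h2, RCLike.inner_apply]
  have hconj : conj (conjSqCoeff n) = conjSqCoeff n := by simp [conjSqCoeff]
  have h0 : ∫ z, (conj z ^ 2 * z ^ n - conjSqCoeff n * z ^ (n - 2)) * conj (v z) ∂diskMeasure = 0 := by
    have := congrArg conj (integral_holomorphic_mul_eq_zero hv hvi n)
    rw [← integral_conj, map_zero] at this
    rw [← this]
    congr 1; ext z
    simp only [map_mul, map_sub, map_pow, Complex.conj_conj, hconj]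
    ring
  rw [inner_toeplitz, inner_add_right, bergmanSpace_inner_smul_right, hmono, hmono, ← integral_const_mul,
    ← integral_add (hmul (by fun_prop)) ((hmul (by fun_prop)).const_mul _), ← sub_eq_zero,
    ← integral_sub]
  · rw [← h0]
    refine integral_congr_ae ?_
    filter_upwards [bergmanMonomial_coeFn n, huv] with z h1 h2
    rw [h1, h2, sqAddConjSq]
    ring
  · refine (hmul (g := fun z => sqAddConjSq z * z ^ n) (by unfold sqAddConjSq; fun_prop)).congr ?_
    filter_upwards [bergmanMonomial_coeFn n, huv] with z h1 h2
    rw [h1, h2]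
  · exact (hmul (by fun_prop)).add ((hmul (by fun_prop)).const_mul _)

/-- Self-adjointness, from the symbol being real. It moves the operator onto the left monomial when
the commutation is read in matrix entries. -/
theorem inner_toeplitz_sqAddConjSq_left (u v : bergmanSpace) :
    inner ℂ (toeplitz sqAddConjSq sqAddConjSq_memLp u) v
      = inner ℂ u (toeplitz sqAddConjSq sqAddConjSq_memLp v) := by
  rw [← bergmanSpace_inner_conj_symm, inner_toeplitz, inner_toeplitz, ← integral_conj]
  congr 1; ext z
  simp only [sqAddConjSq, map_mul, map_add, map_pow, Complex.conj_conj]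
  ring

theorem commutationRelations_of_commute {f : ℂ → ℂ} (hf : MemLp f ∞ diskMeasure)
    (hcomm : toeplitz f hf ∘L toeplitz sqAddConjSq sqAddConjSq_memLp =
      toeplitz sqAddConjSq sqAddConjSq_memLp ∘L toeplitz f hf) :
    CommutationRelations (moment f) := by
  intro n m
  have h := congrArg (fun T : bergmanSpace →L[ℂ] bergmanSpace =>
    inner ℂ (bergmanMonomial m) (T (bergmanMonomial n))) hcomm
  have hconj : conj (conjSqCoeff m) = conjSqCoeff m := by simp [conjSqCoeff]
  simp only [ContinuousLinearMap.comp_apply] at h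
  rw [← inner_toeplitz_sqAddConjSq_left, toeplitz_sqAddConjSq_bergmanMonomial,
    toeplitz_sqAddConjSq_bergmanMonomial, map_add, map_smul, inner_add_right, bergmanSpace_inner_smul_right,
    inner_add_left, bergmanSpace_inner_smul_left, hconj] at h
  simpa only [inner_toeplitz_bergmanMonomial] using h

/-! ### Affine symbols and the conclusion. -/

theorem toeplitz_congr {f g : ℂ → ℂ} (hf : MemLp f ∞ diskMeasure) (hg : MemLp g ∞ diskMeasure)
    (h : f =ᵐ[diskMeasure] g) : toeplitz f hf = toeplitz g hg := by
  rw [toeplitz, toeplitz, (MemLp.toLp_eq_toLp_iff hf hg).2 h]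

theorem toeplitz_affine (c₂ c₀ : ℂ)
    (h : MemLp (fun z => c₂ * (z ^ 2 + conj z ^ 2) + c₀) ∞ diskMeasure) :
    toeplitz (fun z => c₂ * (z ^ 2 + conj z ^ 2) + c₀) h
      = c₂ • toeplitz sqAddConjSq sqAddConjSq_memLp + c₀ • ContinuousLinearMap.id ℂ bergmanSpace := by
  ext1 v
  refine ext_inner_left ℂ fun u => ?_
  have hi : Integrable (fun z => (v : Lp ℂ 2 diskMeasure) z * conj ((u : Lp ℂ 2 diskMeasure) z))
      diskMeasure := by
    have := L2.integrable_inner (𝕜 := ℂ) (u : Lp ℂ 2 diskMeasure) (v : Lp ℂ 2 diskMeasure)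
    simpa only [RCLike.inner_apply] using this
  have hsi : Integrable (fun z => sqAddConjSq z * (v : Lp ℂ 2 diskMeasure) z *
      conj ((u : Lp ℂ 2 diskMeasure) z)) diskMeasure := by
    have hc : Continuous sqAddConjSq := by unfold sqAddConjSq; fun_prop
    obtain ⟨B, hB⟩ := (isCompact_closedBall (0 : ℂ) 1).exists_bound_of_continuousOn hc.continuousOn
    simpa only [mul_assoc] using hi.bounded_mul_diskMeasure hc.aestronglyMeasurable fun z hz =>
      hB z (by simpa using hz.le)
  rw [add_apply, smul_apply, smul_apply,
    ContinuousLinearMap.id_apply, inner_add_right, bergmanSpace_inner_smul_right, bergmanSpace_inner_smul_right,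
    inner_toeplitz, inner_toeplitz, Submodule.coe_inner, L2.inner_def, ← integral_const_mul,
    ← integral_const_mul, ← integral_add (hsi.const_mul _)]
  · congr 1; ext z
    rw [RCLike.inner_apply, sqAddConjSq]
    ring
  · simpa only [RCLike.inner_apply] using hi.const_mul c₀

theorem moment_sqAddConjSq (a b : ℕ) :
    moment sqAddConjSq a b = moment (fun _ => 1) (a + 2) b + moment (fun _ => 1) a (b + 2) := by
  have h1 := integrable_mul_monomial (f := fun _ => 1) (integrable_const 1) (a + 2) b
  have h2 := integrable_mul_monomial (f := fun _ => 1) (integrable_const 1) a (b + 2)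
  rw [moment, moment, moment, ← integral_add h1 h2]
  congr 1; ext z
  rw [sqAddConjSq]
  ring

theorem moment_affine (c₂ c₀ : ℂ) (a b : ℕ) :
    moment (fun z => c₂ * (z ^ 2 + conj z ^ 2) + c₀) a b =
      c₂ * moment sqAddConjSq a b + c₀ * moment (fun _ => 1) a b := by
  have h1 := integrable_mul_monomial sqAddConjSq_memLp.integrable_diskMeasure a b
  have h2 := integrable_mul_monomial (f := fun _ => 1) (integrable_const 1) a b
  rw [moment, moment, moment, ← integral_const_mul, ← integral_const_mul,
    ← integral_add (h1.const_mul _) (h2.const_mul _)]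
  congr 1; ext z
  rw [sqAddConjSq]
  ring

theorem CommutationRelations.sub {M M' : ℕ → ℕ → ℂ} (hM : CommutationRelations M)
    (hM' : CommutationRelations M') : CommutationRelations fun a b => M a b - M' a b := by
  intro n m
  linear_combination hM n m - hM' n m

theorem mainTheorem1 (f : ℂ → ℂ) (hf : MemLp f ∞ diskMeasure) (N : ℤ) (φ : ℤ → ℝ → ℂ)
    (hpolar : HasTruncatedPolarDecomposition f N φ)
    (hcomm : toeplitz f hf ∘L toeplitz sqAddConjSq sqAddConjSq_memLp =
      toeplitz sqAddConjSq sqAddConjSq_memLp ∘L toeplitz f hf) :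
    (∃ c₂ c₀ : ℂ, f =ᵐ[diskMeasure] fun z => c₂ * (z ^ 2 + conj z ^ 2) + c₀) ∧
    ∃ Q : Polynomial ℂ, Q.degree ≤ 1 ∧
      toeplitz f hf = Polynomial.aeval (toeplitz sqAddConjSq sqAddConjSq_memLp) Q := by
  -- The symbol `z² + z̄²` has moment `1/3` at `(0,2)` and `0` at `(0,0)`; the constant `1` has
  -- moments `0` and `1` there.
  set c₂ : ℂ := 3 * moment f 0 2 with hc₂
  set c₀ : ℂ := moment f 0 0 with hc₀
  have hg : MemLp (fun z => c₂ * (z ^ 2 + conj z ^ 2) + c₀) ∞ diskMeasure :=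
    (sqAddConjSq_memLp.const_mul c₂).add (memLp_const c₀)
  have hgcomm : toeplitz _ hg ∘L toeplitz sqAddConjSq sqAddConjSq_memLp =
      toeplitz sqAddConjSq sqAddConjSq_memLp ∘L toeplitz _ hg := by
    rw [toeplitz_affine]
    ext1 v
    simp
  have hsub : ∀ a b, moment (fun z => f z - (c₂ * (z ^ 2 + conj z ^ 2) + c₀)) a b =
      moment f a b - moment (fun z => c₂ * (z ^ 2 + conj z ^ 2) + c₀) a b :=
    moment_sub hf.integrable_diskMeasure hg.integrable_diskMeasure
  have hae : f =ᵐ[diskMeasure] fun z => c₂ * (z ^ 2 + conj z ^ 2) + c₀ := by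
    -- The bound `max N 2` also covers the affine symbol, supported on the diagonals `-2`, `0` and
    -- `2`.
    have h0 := ae_eq_zero_of_moment_eq_zero (hf.sub hg).integrable_diskMeasure
      (moment_eq_zero_of_commutationRelations (K := max N 2) (hf.sub hg) ?_ ?_ ?_ ?_)
    · filter_upwards [h0] with z hz
      exact sub_eq_zero.1 hz
    · have := (commutationRelations_of_commute hf hcomm).sub (commutationRelations_of_commute hg hgcomm)
      simp only [← hsub] at this
      exact this
    · intro k hk a b hab
      have hN : N < k := (le_max_left _ _).trans_lt hk
      have h2 : 2 < k := (le_max_right _ _).trans_lt hk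
      refine (hsub a b).trans ?_
      rw [hpolar.diagonalVanishes hf hN a b hab, moment_affine, moment_sqAddConjSq, moment_one,
        moment_one, moment_one, if_neg (by omega), if_neg (by omega), if_neg (by omega)]
      simp
    · refine (hsub 0 0).trans ?_
      rw [moment_affine, moment_sqAddConjSq, moment_one, moment_one, moment_one]
      simp [hc₀]
    · refine (hsub 0 2).trans ?_
      rw [moment_affine, moment_sqAddConjSq, moment_one, moment_one, moment_one]
      norm_num
      rw [hc₂]
      ring
  refine ⟨⟨c₂, c₀, hae⟩, Polynomial.C c₂ * Polynomial.X + Polynomial.C c₀,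
    Polynomial.degree_linear_le, ?_⟩
  rw [toeplitz_congr hf hg hae, toeplitz_affine, map_add, map_mul, Polynomial.aeval_C,
    Polynomial.aeval_C, Polynomial.aeval_X, Algebra.algebraMap_eq_smul_one,
    Algebra.algebraMap_eq_smul_one, smul_one_mul]
  rfl
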